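/- All systems are finite-dimensional (non-zero) complex Hilbert spaces with fixed orthonormal bases $|i\rangle$; $\mathcal B(A)$ denotes the operators on $A$, $\mathfrak S(A)$ the states (positive operators of trace one) and $\mathcal C(A,B)$ the quantum channels (completely positive trace preserving linear maps $\mathcal B(A)\to\mathcal B(B)$). For a hermitian (that is, adjoint-preserving) linear map $\Phi:\mathcal B(A)\to\mathcal B(B)$ let $\|\Phi\|_\diamond=\max_{\rho\in\mathfrak S(AA)}\|(\Phi\otimes \mathrm{id}_A)(\rho)\|_1$. For a hermitian operator $X$ on $AR$ let $$\|X\|^\diamond_{R|A}=\max\{\langle X,\psi\rangle:\ \psi:\mathcal B(A)\to\mathcal B(R)\text{ hermitian},\ -\alpha\le\psi\le\alpha\text{ for some }\alpha\in\mathcal C(A,R)\},$$ where $\langle X,\psi\rangle=\sum_{i,j}\langle ii|(\psi\otimes \mathrm{id}_R)(X)|jj\rangle$ and $\phi\le\psi$ means that $\psi-\phi$ is completely positive. An ensemble on $A$ is a finite sequence $\mathcal E=\{\lambda_i,\rho_i\}_{i=1}^k$ of states $\rho_i\in\mathfrak S(A)$ with prior probabilities $\lambda_i\ge 0$, $\sum_i\lambda_i=1$;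 its optimal success probability is $P_{\mathrm{succ}}(\mathcal E)=\max_M\sum_i\lambda_i\mathrm{Tr}[\rho_iM_i]$, the maximum being over all measurements $M_1,\dots,M_k\ge0$, $\sum_iM_i=I_A$. For $\Psi\in\mathcal C(A,B)$ and an ensemble $\mathcal E=\{\lambda_i,\rho_i\}$ on $AR$, $(\Psi\otimes \mathrm{id}_R)(\mathcal E)=\{\lambda_i,(\Psi\otimes \mathrm{id}_R)(\rho_i)\}$. **Theorem.** Let $\Phi_1\in\mathcal C(A_0,A_1)$, $\Phi_2\in\mathcal C(A_0,A_1')$ and $\epsilon\ge0$. The minimum $$\delta_{\mathrm{post}}(\Phi_1\|\Phi_2)=\min_{\Lambda\in\mathcal C(A_1,A_1')}\|\Lambda\circ\Phi_1-\Phi_2\|_\diamond$$ is attained, and the following are equivalent. (i) $\delta_{\mathrm{post}}(\Phi_1\|\Phi_2)\le\epsilon$. (ii) For every ancilla $R_1$ and every $\rho\in\mathfrak S(A_0R_1)$, $$\|(\Phi_2\otimes \mathrm{id}_{R_1})(\rho)\|^\diamond_{R_1|A_1'}\le\|(\Phi_1\otimes \mathrm{id}_{R_1})(\rho)\|^\diamond_{R_1|A_1}+\frac{\epsilon}{2}\|\rho\|^\diamond_{R_1|A_0}.$$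 (iii) For every ancilla $R_1$ and every ensemble $\mathcal E$ on $A_0R_1$, $$P_{\mathrm{succ}}((\Phi_2\otimes \mathrm{id}_{R_1})(\mathcal E))\le P_{\mathrm{succ}}((\Phi_1\otimes \mathrm{id}_{R_1})(\mathcal E))+\frac{\epsilon}{2}P_{\mathrm{succ}}(\mathcal E).$$ Moreover, in (ii) and in (iii) it is enough to use a single ancilla $R_1\simeq A_1'$: for any such $R_1$, the condition (ii) for this $R_1$ alone and the condition (iii) for this $R_1$ alone are each equivalent to (i). -/

import Mathlib

open scoped ComplexOrder MatrixOrder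

universe v

noncomputable section

/- A finite-dimensional system with a fixed orthonormal basis indexed by a finite type `a`:
the operators on it are `Matrix a a ℂ`, and the operators on the composite of `a` and `b` are
the matrices indexed by `a × b`. -/

/-- The map `Φ ⊗ id_r`: it applies `Φ` to every block `X_{(·, x), (·, y)}`. -/
def tensorId {a b : Type*} (Φ : Matrix a a ℂ →ₗ[ℂ] Matrix b b ℂ) (r : Type*) :
    Matrix (a × r) (a × r) ℂ →ₗ[ℂ] Matrix (b × r) (b × r) ℂ where
  toFun X := Matrix.of fun p q => Φ (Matrix.of fun i j => X (i, p.2) (j, q.2)) p.1 q.1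
  map_add' X Y := by
    ext p q
    have h : (Matrix.of fun i j => (X + Y) (i, p.2) (j, q.2)) =
        (Matrix.of fun i j => X (i, p.2) (j, q.2)) +
          Matrix.of fun i j => Y (i, p.2) (j, q.2) := rfl
    change Φ _ p.1 q.1 = _
    rw [h, map_add]
    rfl
  map_smul' c X := by
    ext p q
    have h : (Matrix.of fun i j => (c • X) (i, p.2) (j, q.2)) =
        c • (Matrix.of fun i j => X (i, p.2) (j, q.2)) := rfl
    change Φ _ p.1 q.1 = _
    rw [h, map_smul]
    rfl

/-- Complete positivity: `Φ ⊗ id_k` maps positive operators to positive operators for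
every `k`. -/
def IsCP {a b : Type*} (Φ : Matrix a a ℂ →ₗ[ℂ] Matrix b b ℂ) : Prop :=
  ∀ (k : ℕ) (X : Matrix (a × Fin k) (a × Fin k) ℂ),
    X.PosSemidef → (tensorId Φ (Fin k) X).PosSemidef

/-- Quantum channels: completely positive trace preserving maps. -/
def IsChannel {a b : Type*} [Fintype a] [Fintype b]
    (Φ : Matrix a a ℂ →ₗ[ℂ] Matrix b b ℂ) : Prop :=
  IsCP Φ ∧ ∀ X, (Φ X).trace = X.trace

/-- States: positive operators of trace one. -/
def IsState {a : Type*} [Fintype a] (ρ : Matrix a a ℂ) : Prop :=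
  ρ.PosSemidef ∧ ρ.trace = 1

/-- The trace norm `Tr √(X* X)`. -/
def traceNorm {a : Type*} [Fintype a] [DecidableEq a] (X : Matrix a a ℂ) : ℝ :=
  (CFC.abs X).trace.re

/-- The diamond norm of a hermitian map `Φ` on operators on `a`: the largest trace norm of
`(Φ ⊗ id_a)(ρ)` over all states `ρ` on `a × a`. -/
def diamondNorm {a b : Type*} [Fintype a] [DecidableEq a] [Fintype b] [DecidableEq b]
    (Φ : Matrix a a ℂ →ₗ[ℂ] Matrix b b ℂ) : ℝ :=
  sSup {x | ∃ ρ : Matrix (a × a) (a × a) ℂ, IsState ρ ∧ x = traceNorm (tensorId Φ a ρ)}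

/-- The duality `⟨X, φ⟩ = ⟪I_r| (φ ⊗ id_r)(X) |I_r⟫`, where `|I_r⟫ = ∑ᵢ |i⟩ ⊗ |i⟩`, between
hermitian operators `X` on `a × r` and hermitian maps `φ` from operators on `a` to operators
on `r` (the value is real for those). -/
def pairing {a r : Type*} [Fintype r]
    (X : Matrix (a × r) (a × r) ℂ) (φ : Matrix a a ℂ →ₗ[ℂ] Matrix r r ℂ) : ℝ :=
  (∑ i : r, ∑ j : r, tensorId φ r X (i, i) (j, j)).re

/-- The norm `‖X‖^⋄_{r|a}` of a hermitian operator `X` on `a × r`, dual to the diamond norm on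
hermitian maps from `a` to `r`: the largest value of `⟨X, ψ⟩` over all `ψ` with
`-α ≤ ψ ≤ α` (in the order of the completely positive cone) for some channel `α`. -/
def dualDiamondNorm {a r : Type*} [Fintype a] [Fintype r]
    (X : Matrix (a × r) (a × r) ℂ) : ℝ :=
  sSup {x | ∃ ψ α : Matrix a a ℂ →ₗ[ℂ] Matrix r r ℂ,
    IsChannel α ∧ IsCP (α - ψ) ∧ IsCP (α + ψ) ∧ x = pairing X ψ}

/-- Ensembles of `k` states `ρ i` with prior probabilities `p i`. -/
def IsEnsemble {a : Type*} [Fintype a] {k : ℕ} (p : Fin k → ℝ) (ρ : Fin k → Matrix a a ℂ) :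
    Prop :=
  (∀ i, 0 ≤ p i) ∧ ∑ i, p i = 1 ∧ ∀ i, IsState (ρ i)

/-- Measurements with `k` outcomes. -/
def IsMeasurement {a : Type*} [Fintype a] [DecidableEq a] {k : ℕ}
    (M : Fin k → Matrix a a ℂ) : Prop :=
  (∀ i, (M i).PosSemidef) ∧ ∑ i, M i = 1

/-- The optimal success probability of guessing the member of the ensemble `(p i, ρ i)`. -/
def guessProb {a : Type*} [Fintype a] [DecidableEq a] {k : ℕ}
    (p : Fin k → ℝ) (ρ : Fin k → Matrix a a ℂ) : ℝ :=
  sSup {x | ∃ M : Fin k → Matrix a a ℂ, IsMeasurement M ∧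
    x = ∑ i, p i * (ρ i * M i).trace.re}

section Comparison

variable {a₀ a₁ a₁' : Type*} [Fintype a₀] [DecidableEq a₀] [Fintype a₁] [DecidableEq a₁]
  [Fintype a₁'] [DecidableEq a₁']

/-- The distances to `Φ₂` of the postprocessings of `Φ₁`. -/
def postDistances (Φ₁ : Matrix a₀ a₀ ℂ →ₗ[ℂ] Matrix a₁ a₁ ℂ)
    (Φ₂ : Matrix a₀ a₀ ℂ →ₗ[ℂ] Matrix a₁' a₁' ℂ) : Set ℝ :=
  {x | ∃ Λ : Matrix a₁ a₁ ℂ →ₗ[ℂ] Matrix a₁' a₁' ℂ,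
    IsChannel Λ ∧ x = diamondNorm (Λ ∘ₗ Φ₁ - Φ₂)}

/-- The postprocessing deficiency `δ_post(Φ₁‖Φ₂)`. -/
def postDeficiency (Φ₁ : Matrix a₀ a₀ ℂ →ₗ[ℂ] Matrix a₁ a₁ ℂ)
    (Φ₂ : Matrix a₀ a₀ ℂ →ₗ[ℂ] Matrix a₁' a₁' ℂ) : ℝ :=
  sInf (postDistances Φ₁ Φ₂)

/-- The comparison of the dual norms (conditional min-entropies) of the outputs for all input
states with ancilla `r`. -/
def DualNormComparison (Φ₁ : Matrix a₀ a₀ ℂ →ₗ[ℂ] Matrix a₁ a₁ ℂ)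
    (Φ₂ : Matrix a₀ a₀ ℂ →ₗ[ℂ] Matrix a₁' a₁' ℂ) (ε : ℝ) (r : Type*) [Fintype r] : Prop :=
  ∀ ρ : Matrix (a₀ × r) (a₀ × r) ℂ, IsState ρ →
    dualDiamondNorm (tensorId Φ₂ r ρ) ≤
      dualDiamondNorm (tensorId Φ₁ r ρ) + ε / 2 * dualDiamondNorm ρ

/-- The comparison of the success probabilities for the outputs of all input ensembles with
ancilla `r`. -/
def GuessingComparison (Φ₁ : Matrix a₀ a₀ ℂ →ₗ[ℂ] Matrix a₁ a₁ ℂ)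
    (Φ₂ : Matrix a₀ a₀ ℂ →ₗ[ℂ] Matrix a₁' a₁' ℂ) (ε : ℝ)
    (r : Type*) [Fintype r] [DecidableEq r] : Prop :=
  ∀ (k : ℕ) (p : Fin k → ℝ) (ρ : Fin k → Matrix (a₀ × r) (a₀ × r) ℂ), IsEnsemble p ρ →
    guessProb p (fun i => tensorId Φ₂ r (ρ i)) ≤
      guessProb p (fun i => tensorId Φ₁ r (ρ i)) + ε / 2 * guessProb p ρ

end Comparison

end

open Matrix Kronecker

/-! The proof turns diamond-norm bounds into order relations. If `Ψ - Φ ≤ (t/2) β` for channels `Φ`,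
`Ψ`, `β`, then the diamond norm of `Φ - Ψ` is at most `t` (`diamondNorm_sub_le`); a one-sided bound
suffices because a difference of channels has outputs of trace zero. Conversely such a `β` exists
for every `t` above the norm (`exists_isChannel_ge_sub`). This is semidefinite duality. For positive
definite `σ`, conjugating the Choi matrix by `1 ⊗ √σ` gives a multiple of an output on a pure state,
whose positive part yields a dominating operator that is cheap against `σ`; Sion's minimax theorem
then gives one operator that works for all states. Compactness provides a best `Λ` and a `β` with
the exact constant, so (i) becomes `Φ₂ ≤ Λ ∘ Φ₁ + (ε/2) β`.

(i) gives (iii) by pulling measurements back through `Λ` and `β`.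

(iii) gives (ii) because the dual norm of a state is, up to a fixed factor, the guessing probability
of the uniform ensemble of its conjugates by signed permutations of the ancilla
(`guessProb_signedPermConj`). These conjugations commute with `Φ ⊗ id`.

(ii) gives (i) by a second minimax. On positive operators the dual norm is a maximum over channels,
and when the ancilla is a copy of the output of `Φ₂`, the identification is a competitor. Hence each
`ρ` has its own `Λ` and `β`; minimax makes them independent of `ρ`, and self-duality of the positive
cone turns the resulting inequality for all states into complete positivity. -/

theorem Matrix.PosSemidef.exists_eq_conjTranspose_mul_self {n : Type*} [Fintype n]
    {A : Matrix n n ℂ} (hA : A.PosSemidef) : ∃ B : Matrix n n ℂ, A = Bᴴ * B := by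
  classical
  exact CStarAlgebra.nonneg_iff_eq_star_mul_self.mp hA.nonneg

theorem Matrix.PosSemidef.re_trace_mul_nonneg {n : Type*} [Fintype n]
    {A B : Matrix n n ℂ} (hA : A.PosSemidef) (hB : B.PosSemidef) : 0 ≤ (A * B).trace.re := by
  obtain ⟨D, rfl⟩ := hA.exists_eq_conjTranspose_mul_self
  rw [Matrix.mul_assoc, Matrix.trace_mul_comm]
  exact (Complex.le_def.1 (hB.mul_mul_conjTranspose_same D).trace_nonneg).1

theorem Matrix.PosSemidef.re_trace_nonneg {n : Type*} [Fintype n]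
    {A : Matrix n n ℂ} (hA : A.PosSemidef) : 0 ≤ A.trace.re :=
  (Complex.le_def.1 hA.trace_nonneg).1

theorem Matrix.PosSemidef.real_smul {n : Type*} {A : Matrix n n ℂ} (hA : A.PosSemidef)
    {c : ℝ} (hc : 0 ≤ c) : ((c : ℂ) • A).PosSemidef :=
  hA.smul (by exact_mod_cast hc)

/-- An entry of a Gram matrix is bounded by the mean of two diagonal entries. This supplies the
boundedness in the compactness arguments. -/
theorem Matrix.PosSemidef.norm_apply_le_trace {n : Type*} [Fintype n]
    {A : Matrix n n ℂ} (hA : A.PosSemidef) (i j : n) : ‖A i j‖ ≤ A.trace.re := by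
  classical
  have hdiag : ∀ i, (A i i).re ≤ A.trace.re := fun i => by
    rw [Matrix.trace, Complex.re_sum]
    exact Finset.single_le_sum (f := fun i => (A i i).re)
      (fun k _ => (Complex.le_def.1 hA.diag_nonneg).1) (Finset.mem_univ i)
  suffices h : ‖A i j‖ ≤ ((A i i).re + (A j j).re) / 2 by
    linarith [hdiag i, hdiag j]
  obtain ⟨D, rfl⟩ := hA.exists_eq_conjTranspose_mul_self
  have hd : ∀ i, ((Dᴴ * D) i i).re = ∑ m, ‖D m i‖ ^ 2 := fun i => by
    simp only [Matrix.mul_apply, Matrix.conjTranspose_apply, Complex.re_sum]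
    refine Finset.sum_congr rfl fun m _ => ?_
    rw [← Complex.normSq_eq_norm_sq, Complex.star_def, mul_comm, Complex.mul_conj,
      Complex.ofReal_re]
  rw [hd, hd, Matrix.mul_apply, ← Finset.sum_add_distrib, Finset.sum_div]
  refine (norm_sum_le _ _).trans (Finset.sum_le_sum fun m _ => ?_)
  rw [Matrix.conjTranspose_apply, norm_mul, norm_star]
  nlinarith [sq_nonneg (‖D m i‖ - ‖D m j‖)]

theorem sum_sum_sum_sum_comm {ι κ M : Type*} [Fintype ι] [Fintype κ] [AddCommMonoid M]
    {ι' κ' : Type*} [Fintype ι'] [Fintype κ'] (F : ι → κ → ι' → κ' → M) :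
    ∑ i, ∑ j, ∑ m, ∑ n, F i j m n = ∑ m, ∑ n, ∑ i, ∑ j, F i j m n := by
  calc _ = ∑ i, ∑ m, ∑ n, ∑ j, F i j m n := Finset.sum_congr rfl fun i _ => by
        rw [Finset.sum_comm]
        exact Finset.sum_congr rfl fun m _ => Finset.sum_comm
    _ = ∑ m, ∑ i, ∑ n, ∑ j, F i j m n := Finset.sum_comm
    _ = _ := Finset.sum_congr rfl fun m _ => Finset.sum_comm

/-! ### Choi matrices and complete positivity -/

section Choi

variable {a b c : Type*}

/-- The linear map with a given Choi matrix. -/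
noncomputable def ofChoi [Fintype a] :
    Matrix (b × a) (b × a) ℂ →ₗ[ℂ] (Matrix a a ℂ →ₗ[ℂ] Matrix b b ℂ) :=
  LinearMap.mk₂ ℂ (fun C X => Matrix.of fun p q => ∑ i, ∑ j, X i j * C (p, i) (q, j))
    (fun C D X => by ext; simp [mul_add, Finset.sum_add_distrib])
    (fun t C X => by ext; simp [Finset.mul_sum, mul_left_comm])
    (fun C X Y => by ext; simp [add_mul, Finset.sum_add_distrib])
    (fun t C X => by ext; simp [Finset.mul_sum, mul_assoc])

theorem ofChoi_apply [Fintype a] (C : Matrix (b × a) (b × a) ℂ) (X : Matrix a a ℂ) (p q : b) :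
    ofChoi C X p q = ∑ i, ∑ j, X i j * C (p, i) (q, j) := rfl

/-- The Choi matrix of a linear map. -/
def choi [DecidableEq a] (Φ : Matrix a a ℂ →ₗ[ℂ] Matrix b b ℂ) : Matrix (b × a) (b × a) ℂ :=
  Matrix.of fun p q => Φ (Matrix.single p.2 q.2 1) p.1 q.1

theorem choi_apply [DecidableEq a] (Φ : Matrix a a ℂ →ₗ[ℂ] Matrix b b ℂ) (p q : b × a) :
    choi Φ p q = Φ (Matrix.single p.2 q.2 1) p.1 q.1 := rfl

theorem ofChoi_choi [Fintype a] [DecidableEq a] (Φ : Matrix a a ℂ →ₗ[ℂ] Matrix b b ℂ) :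
    ofChoi (choi Φ) = Φ := by
  ext X p q
  rw [ofChoi_apply]
  conv_rhs => rw [Matrix.matrix_eq_sum_single X]
  simp only [map_sum, Matrix.sum_apply, choi_apply]
  refine Finset.sum_congr rfl fun i _ => Finset.sum_congr rfl fun j _ => ?_
  have : Matrix.single i j (X i j) = X i j • Matrix.single i j (1 : ℂ) := by
    simp [Matrix.smul_single]
  rw [this, map_smul]
  rfl

theorem choi_ofChoi [Fintype a] [DecidableEq a] (C : Matrix (b × a) (b × a) ℂ) :
    choi (ofChoi C) = C := by
  ext p q
  simp [choi_apply, ofChoi_apply, Matrix.single_apply, ite_and]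

theorem choi_sub [DecidableEq a] (Φ Ψ : Matrix a a ℂ →ₗ[ℂ] Matrix b b ℂ) :
    choi (Φ - Ψ) = choi Φ - choi Ψ := rfl

theorem choi_smul [DecidableEq a] (t : ℂ) (Φ : Matrix a a ℂ →ₗ[ℂ] Matrix b b ℂ) :
    choi (t • Φ) = t • choi Φ := rfl

theorem tensorId_apply (Φ : Matrix a a ℂ →ₗ[ℂ] Matrix b b ℂ) (r : Type*)
    (X : Matrix (a × r) (a × r) ℂ) (p q : b × r) :
    tensorId Φ r X p q = Φ (Matrix.of fun i j => X (i, p.2) (j, q.2)) p.1 q.1 := rfl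

theorem tensorId_comp (Ψ : Matrix b b ℂ →ₗ[ℂ] Matrix c c ℂ) (Φ : Matrix a a ℂ →ₗ[ℂ] Matrix b b ℂ)
    (r : Type*) (X : Matrix (a × r) (a × r) ℂ) :
    tensorId (Ψ ∘ₗ Φ) r X = tensorId Ψ r (tensorId Φ r X) := rfl

theorem tensorId_add (Φ Ψ : Matrix a a ℂ →ₗ[ℂ] Matrix b b ℂ)
    (r : Type*) (X : Matrix (a × r) (a × r) ℂ) :
    tensorId (Φ + Ψ) r X = tensorId Φ r X + tensorId Ψ r X := rfl

theorem tensorId_sub (Φ Ψ : Matrix a a ℂ →ₗ[ℂ] Matrix b b ℂ)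
    (r : Type*) (X : Matrix (a × r) (a × r) ℂ) :
    tensorId (Φ - Ψ) r X = tensorId Φ r X - tensorId Ψ r X := rfl

theorem tensorId_smul (t : ℂ) (Φ : Matrix a a ℂ →ₗ[ℂ] Matrix b b ℂ)
    (r : Type*) (X : Matrix (a × r) (a × r) ℂ) :
    tensorId (t • Φ) r X = t • tensorId Φ r X := rfl

/-- Gram factors `D` of the Choi matrix and `B` of the input combine into a Gram factor `G` of the
output, a form of the Kraus decomposition. -/
theorem tensorId_ofChoi_posSemidef [Fintype a] [Fintype b] {C : Matrix (b × a) (b × a) ℂ}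
    (hC : C.PosSemidef) {r : Type*} [Fintype r] {X : Matrix (a × r) (a × r) ℂ}
    (hX : X.PosSemidef) : (tensorId (ofChoi C) r X).PosSemidef := by
  obtain ⟨D, rfl⟩ := hC.exists_eq_conjTranspose_mul_self
  obtain ⟨B, rfl⟩ := hX.exists_eq_conjTranspose_mul_self
  let G : Matrix ((a × r) × (b × a)) (b × r) ℂ :=
    Matrix.of fun m p => ∑ i, B m.1 (i, p.2) * D m.2 (p.1, i)
  have : tensorId (ofChoi (Dᴴ * D)) r (Bᴴ * B) = Gᴴ * G := by
    ext p q
    simp only [tensorId_apply, ofChoi_apply, Matrix.mul_apply, Matrix.conjTranspose_apply,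
      Matrix.of_apply, G, Fintype.sum_prod_type (α₁ := a × r) (α₂ := b × a), star_sum, star_mul']
    simp only [Finset.sum_mul_sum]
    rw [← sum_sum_sum_sum_comm]
    refine Finset.sum_congr rfl fun i _ => Finset.sum_congr rfl fun j _ =>
      Finset.sum_congr rfl fun m _ => Finset.sum_congr rfl fun n _ => by ring
  rw [this]
  exact Matrix.posSemidef_conjTranspose_mul_self G

/-- The Choi matrix is, up to relabelling, the output of `Φ ⊗ id` on the unnormalised maximally
entangled vector `v`. -/
theorem isCP_iff_choi_posSemidef [Fintype a] [DecidableEq a] [Fintype b]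
    {Φ : Matrix a a ℂ →ₗ[ℂ] Matrix b b ℂ} : IsCP Φ ↔ (choi Φ).PosSemidef := by
  refine ⟨fun h => ?_, fun h k X hX => ?_⟩
  · let e := Fintype.equivFin a
    let v : a × Fin (Fintype.card a) → ℂ := fun p => if e p.1 = p.2 then 1 else 0
    have h1 := (h _ _ (Matrix.posSemidef_vecMulVec_self_star v)).submatrix
      (Prod.map id e : b × a → b × Fin (Fintype.card a))
    convert h1 using 1
    ext p q
    simp only [choi_apply, Matrix.submatrix_apply, tensorId_apply, Prod.map_fst, Prod.map_snd, id]
    have : Matrix.single p.2 q.2 (1 : ℂ) =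
        Matrix.of fun i j => Matrix.vecMulVec v (star v) (i, e p.2) (j, e q.2) := by
      ext i j
      simp [v, Matrix.vecMulVec_apply, Matrix.single_apply, ite_and, eq_comm]
      split_ifs <;> rfl
    rw [this]
  · rw [← ofChoi_choi Φ]
    exact tensorId_ofChoi_posSemidef h hX

theorem IsCP.tensorId_posSemidef [Fintype a] [Fintype b]
    {Φ : Matrix a a ℂ →ₗ[ℂ] Matrix b b ℂ} (hΦ : IsCP Φ) {r : Type*} [Fintype r]
    {X : Matrix (a × r) (a × r) ℂ} (hX : X.PosSemidef) : (tensorId Φ r X).PosSemidef := by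
  classical
  rw [← ofChoi_choi Φ]
  exact tensorId_ofChoi_posSemidef (isCP_iff_choi_posSemidef.1 hΦ) hX

theorem IsCP.comp {Ψ : Matrix b b ℂ →ₗ[ℂ] Matrix c c ℂ} {Φ : Matrix a a ℂ →ₗ[ℂ] Matrix b b ℂ}
    (hΨ : IsCP Ψ) (hΦ : IsCP Φ) : IsCP (Ψ ∘ₗ Φ) := fun k X hX => hΨ k _ (hΦ k X hX)

theorem IsCP.add {Φ Ψ : Matrix a a ℂ →ₗ[ℂ] Matrix b b ℂ}
    (hΦ : IsCP Φ) (hΨ : IsCP Ψ) : IsCP (Φ + Ψ) := fun k X hX => (hΦ k X hX).add (hΨ k X hX)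

theorem IsCP.real_smul {Φ : Matrix a a ℂ →ₗ[ℂ] Matrix b b ℂ}
    (hΦ : IsCP Φ) {t : ℝ} (ht : 0 ≤ t) : IsCP ((t : ℂ) • Φ) :=
  fun k X hX => (hΦ k X hX).real_smul ht

theorem IsChannel.comp [Fintype a] [Fintype b] [Fintype c] {Ψ : Matrix b b ℂ →ₗ[ℂ] Matrix c c ℂ}
    {Φ : Matrix a a ℂ →ₗ[ℂ] Matrix b b ℂ} (hΨ : IsChannel Ψ) (hΦ : IsChannel Φ) :
    IsChannel (Ψ ∘ₗ Φ) :=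
  ⟨hΨ.1.comp hΦ.1, fun X => (hΨ.2 _).trans (hΦ.2 X)⟩

theorem trace_tensorId [Fintype a] [Fintype b] {Φ : Matrix a a ℂ →ₗ[ℂ] Matrix b b ℂ}
    (hΦ : ∀ X, (Φ X).trace = X.trace) (r : Type*) [Fintype r] (X : Matrix (a × r) (a × r) ℂ) :
    (tensorId Φ r X).trace = X.trace := by
  simp only [Matrix.trace, Matrix.diag, Fintype.sum_prod_type_right, tensorId_apply]
  exact Finset.sum_congr rfl fun x _ => hΦ _

theorem IsChannel.isState_tensorId [Fintype a] [Fintype b] {Φ : Matrix a a ℂ →ₗ[ℂ] Matrix b b ℂ}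
    (hΦ : IsChannel Φ) {r : Type*} [Fintype r] {ρ : Matrix (a × r) (a × r) ℂ} (hρ : IsState ρ) :
    IsState (tensorId Φ r ρ) :=
  ⟨hΦ.1.tensorId_posSemidef hρ.1, (trace_tensorId hΦ.2 r ρ).trans hρ.2⟩

/-- Trace preservation is an affine condition on the partial trace of the Choi matrix, so channels
form a compact convex set of matrices. -/
theorem isChannel_ofChoi_iff [Fintype a] [DecidableEq a] [Fintype b]
    {C : Matrix (b × a) (b × a) ℂ} : IsChannel (ofChoi C) ↔
      C.PosSemidef ∧ ∀ i j, ∑ p, C (p, i) (p, j) = (1 : Matrix a a ℂ) i j := by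
  rw [IsChannel, isCP_iff_choi_posSemidef, choi_ofChoi]
  have htr : ∀ X : Matrix a a ℂ,
      (ofChoi C X).trace = ∑ i, ∑ j, X i j * ∑ p, C (p, i) (p, j) := fun X => by
    simp only [Matrix.trace, Matrix.diag, ofChoi_apply, Finset.mul_sum]
    rw [Finset.sum_comm]
    exact Finset.sum_congr rfl fun i _ => Finset.sum_comm
  refine and_congr_right fun _ => ⟨fun h i j => ?_, fun h X => ?_⟩
  · have := h (Matrix.single i j 1)
    rw [htr] at this
    simpa [Matrix.single_apply, ite_and, Matrix.trace, Matrix.one_apply, eq_comm] using this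
  · rw [htr]
    simp [h, Matrix.one_apply, Matrix.trace]

end Choi

/-! ### The pairing between operators and maps -/

section Pairing

variable {a b r : Type*}

theorem pairing_comp [Fintype r] (X : Matrix (a × r) (a × r) ℂ)
    (φ : Matrix b b ℂ →ₗ[ℂ] Matrix r r ℂ) (Φ : Matrix a a ℂ →ₗ[ℂ] Matrix b b ℂ) :
    pairing X (φ ∘ₗ Φ) = pairing (tensorId Φ r X) φ := rfl

theorem pairing_add [Fintype r] (X : Matrix (a × r) (a × r) ℂ)
    (φ ψ : Matrix a a ℂ →ₗ[ℂ] Matrix r r ℂ) :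
    pairing X (φ + ψ) = pairing X φ + pairing X ψ := by
  simp [pairing, tensorId_add, Finset.sum_add_distrib]

theorem pairing_sub [Fintype r] (X : Matrix (a × r) (a × r) ℂ)
    (φ ψ : Matrix a a ℂ →ₗ[ℂ] Matrix r r ℂ) :
    pairing X (φ - ψ) = pairing X φ - pairing X ψ := by
  simp [pairing, tensorId_sub, Finset.sum_sub_distrib]

theorem pairing_real_smul [Fintype r] (X : Matrix (a × r) (a × r) ℂ) (t : ℝ)
    (φ : Matrix a a ℂ →ₗ[ℂ] Matrix r r ℂ) :
    pairing X ((t : ℂ) • φ) = t * pairing X φ := by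
  simp [pairing, tensorId_smul, Finset.mul_sum]

/-- The pairing is the quadratic form of the output at the unnormalised maximally entangled vector.
-/
theorem pairing_nonneg [Fintype a] [Fintype r] {X : Matrix (a × r) (a × r) ℂ} (hX : X.PosSemidef)
    {φ : Matrix a a ℂ →ₗ[ℂ] Matrix r r ℂ} (hφ : IsCP φ) : 0 ≤ pairing X φ := by
  classical
  have h := (hφ.tensorId_posSemidef hX).dotProduct_mulVec_nonneg
    (fun p : r × r => if p.1 = p.2 then 1 else 0)
  have h' := (Complex.le_def.1 h).1
  simp only [dotProduct, Matrix.mulVec, Fintype.sum_prod_type, Pi.star_apply, apply_ite star,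
    star_one, star_zero, ite_mul, mul_ite, one_mul, zero_mul, mul_one, mul_zero,
    Finset.sum_ite_eq, Finset.mem_univ, if_true, Complex.zero_re] at h'
  exact h'

theorem pairing_ofChoi [Fintype a] [Fintype r] (X : Matrix (a × r) (a × r) ℂ)
    (C : Matrix (r × a) (r × a) ℂ) :
    pairing X (ofChoi C) = (∑ p, ∑ q, X p q * C p.swap q.swap).re := by
  simp only [pairing, tensorId_apply, ofChoi_apply, Matrix.of_apply, Fintype.sum_prod_type_right]
  congr 1
  refine Finset.sum_congr rfl fun x _ => ?_
  rw [Finset.sum_comm]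
  refine Finset.sum_congr rfl fun i _ => rfl

/-- The pairing with a map is the trace pairing with its transposed Choi matrix. -/
theorem pairing_ofChoi_eq_trace [Fintype a] [Fintype r] (X N : Matrix (a × r) (a × r) ℂ) :
    pairing X (ofChoi (Nᵀ.submatrix Prod.swap Prod.swap)) = (X * N).trace.re := by
  rw [pairing_ofChoi]
  simp [Matrix.trace, Matrix.mul_apply]

end Pairing

/-! ### Trace norm estimates -/

section TraceNorm

variable {n : Type*} [Fintype n] [DecidableEq n]

theorem traceNorm_sub_le {P N : Matrix n n ℂ} (hP : P.PosSemidef) (hN : N.PosSemidef) :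
    traceNorm (P - N) ≤ P.trace.re + N.trace.re := by
  have hX : IsSelfAdjoint (P - N) := hP.isHermitian.sub hN.isHermitian
  set X := P - N with hXdef
  -- The spectrum is finite, so even the discontinuous sign function is admissible in the functional
  -- calculus. With `H` the sign of `X`, `|X| = H X` and `-1 ≤ H ≤ 1`.
  have hcont : ∀ f : ℝ → ℝ, ContinuousOn f (spectrum ℝ X) := fun f =>
    (Set.Finite.continuousOn (Matrix.finite_real_spectrum) f)
  let H : Matrix n n ℂ := cfc (fun x : ℝ => if 0 ≤ x then (1 : ℝ) else -1) X
  have habs : CFC.abs X = H * X := by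
    rw [CFC.abs_eq_cfc_norm X hX]
    conv_rhs => rw [← cfc_id' ℝ X hX]
    rw [← cfc_mul _ _ X (hcont _) (hcont _)]
    congr 1
    ext x
    rw [Real.norm_eq_abs]
    split_ifs with h
    · rw [abs_of_nonneg h, one_mul]
    · rw [abs_of_neg (not_le.1 h), neg_one_mul]
  have h1 : (1 - H).PosSemidef := by
    rw [← Matrix.le_iff, ← cfc_one ℝ X hX]
    refine cfc_mono (fun x _ => ?_) (hcont _) (hcont _)
    split_ifs <;> norm_num
  have h2 : (1 + H).PosSemidef := by
    have : (-1 : Matrix n n ℂ) ≤ H := by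
      rw [← cfc_one ℝ X hX, ← cfc_neg]
      refine cfc_mono (fun x _ => ?_) (hcont _) (hcont _)
      split_ifs <;> norm_num
    simpa only [Matrix.le_iff, sub_neg_eq_add, add_comm] using this
  have e1 := h1.re_trace_mul_nonneg hP
  have e2 := h2.re_trace_mul_nonneg hN
  rw [traceNorm, habs, hXdef, mul_sub]
  simp only [sub_mul, add_mul, one_mul, Matrix.trace_sub, Matrix.trace_add, Complex.sub_re,
    Complex.add_re] at e1 e2 ⊢
  linarith

theorem exists_posSemidef_trace_eq_traceNorm {X : Matrix n n ℂ} (hX : X.IsHermitian) :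
    ∃ Q : Matrix n n ℂ, Q.PosSemidef ∧ (Q - X).PosSemidef ∧
      Q.trace.re = (traceNorm X + X.trace.re) / 2 := by
  refine ⟨X⁺, (CFC.posPart_nonneg X).posSemidef, ?_, ?_⟩
  · have := CFC.posPart_sub_negPart X hX
    have h2 : X⁺ - X = X⁻ := by rw [sub_eq_iff_eq_add, add_comm, ← sub_eq_iff_eq_add, this]
    rw [h2]
    exact (CFC.negPart_nonneg X).posSemidef
  · have := congrArg (fun Y => (Matrix.trace Y).re) (CFC.abs_add_self X hX)
    simp only [Matrix.trace_add, Complex.add_re, two_smul] at this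
    rw [traceNorm]
    linarith

theorem traceNorm_neg (X : Matrix n n ℂ) : traceNorm (-X) = traceNorm X := by
  rw [traceNorm, CFC.abs_neg, traceNorm]

end TraceNorm

/-- A minimax principle for functions that are affine in each variable. -/
theorem exists_forall_le_zero_of_forall_exists {E F : Type*}
    [TopologicalSpace E] [AddCommGroup E] [Module ℝ E] [IsTopologicalAddGroup E]
    [ContinuousSMul ℝ E] [TopologicalSpace F] [AddCommGroup F] [Module ℝ F]
    [IsTopologicalAddGroup F] [ContinuousSMul ℝ F] {X : Set E} {Y : Set F} {f : E → F → ℝ}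
    (cX : Convex ℝ X) (kX : IsCompact X) (cY : Convex ℝ Y) (kY : IsCompact Y)
    (hf₁ : ∀ y, Continuous fun x => f x y) (hf₂ : ∀ x, Continuous (f x))
    (haff₁ : ∀ x x' y (s t : ℝ), s + t = 1 → f (s • x + t • x') y = s * f x y + t * f x' y)
    (haff₂ : ∀ x y y' (s t : ℝ), s + t = 1 → f x (s • y + t • y') = s * f x y + t * f x y')
    (hY : Y.Nonempty) (h : ∀ y ∈ Y, ∃ x ∈ X, f x y ≤ 0) :
    ∃ x ∈ X, ∀ y ∈ Y, f x y ≤ 0 := by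
  obtain ⟨y₀, hy₀⟩ := hY
  obtain ⟨x₀, hx₀, -⟩ := h y₀ hy₀
  have hconv : ∀ y, ConvexOn ℝ X fun x => f x y := fun y =>
    ⟨cX, fun x _ x' _ s t _ _ hst => (haff₁ x x' y s t hst).le⟩
  have hconc : ∀ x, ConcaveOn ℝ Y (f x) := fun x =>
    ⟨cY, fun y _ y' _ s t _ _ hst => (haff₂ x y y' s t hst).ge⟩
  obtain ⟨a, ha, b, hb, hab⟩ := Sion.exists_isSaddlePointOn (f := f) ⟨x₀, hx₀⟩ cX kX
    (fun y _ => (hf₁ y).lowerSemicontinuous.lowerSemicontinuousOn _)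
    (fun y _ => (hconv y).quasiconvexOn) cY ⟨y₀, hy₀⟩ kY
    (fun x _ => (hf₂ x).upperSemicontinuous.upperSemicontinuousOn _)
    (fun x _ => (hconc x).quasiconcaveOn)
  -- At the saddle point `(a, b)`, `f a y ≤ f x b` for all `x` and `y`; it is enough to choose `x`
  -- feasible for `b`.
  obtain ⟨x, hx, hxb⟩ := h b hb
  exact ⟨a, ha, fun y hy => (hab x hx y hy).trans hxb⟩

/-! ### Compactness and convexity of positive operators and states -/

section Compactness

variable {n : Type*} [Fintype n]

theorem isClosed_setOf_posSemidef : IsClosed {A : Matrix n n ℂ | A.PosSemidef} := by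
  simp only [Matrix.posSemidef_iff_dotProduct_mulVec, Matrix.IsHermitian, Set.ofPred_and,
    Set.ofPred_forall]
  refine IsClosed.inter (isClosed_eq (by fun_prop) (by fun_prop)) (isClosed_iInter fun x => ?_)
  refine isClosed_le continuous_const ?_
  simp only [dotProduct, Matrix.mulVec]
  fun_prop

theorem isCompact_setOf_posSemidef_trace_le (c : ℝ) :
    IsCompact {A : Matrix n n ℂ | A.PosSemidef ∧ A.trace.re ≤ c} := by
  have h : IsCompact (Set.univ.pi fun _ : n => Set.univ.pi fun _ : n =>
      Metric.closedBall (0 : ℂ) c) :=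
    isCompact_univ_pi fun _ => isCompact_univ_pi fun _ => isCompact_closedBall _ _
  refine h.of_isClosed_subset ?_ fun A hA i _ j _ => ?_
  · refine isClosed_setOf_posSemidef.inter (isClosed_le
      (Complex.continuous_re.comp continuous_id.matrix_trace) continuous_const)
  · rw [mem_closedBall_zero_iff]
    exact (hA.1.norm_apply_le_trace i j).trans hA.2

omit [Fintype n] in
theorem convex_setOf_posSemidef : Convex ℝ {A : Matrix n n ℂ | A.PosSemidef} := by
  intro A hA B hB s t hs ht _
  have := (hA.real_smul hs).add (hB.real_smul ht)
  rw [Complex.coe_smul, Complex.coe_smul] at this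
  exact this

theorem isCompact_setOf_isState : IsCompact {A : Matrix n n ℂ | IsState A} := by
  refine (isCompact_setOf_posSemidef_trace_le 1).of_isClosed_subset ?_ fun A hA => ⟨hA.1, ?_⟩
  · refine isClosed_setOf_posSemidef.inter (isClosed_eq (by fun_prop) continuous_const)
  · rw [hA.2, Complex.one_re]

theorem convex_setOf_isState : Convex ℝ {A : Matrix n n ℂ | IsState A} := by
  intro A hA B hB s t hs ht hst
  refine ⟨convex_setOf_posSemidef hA.1 hB.1 hs ht hst, ?_⟩
  rw [Matrix.trace_add, Matrix.trace_smul, Matrix.trace_smul, hA.2, hB.2, ← add_smul, hst, one_smul]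

theorem exists_isState [Nonempty n] : ∃ A : Matrix n n ℂ, IsState A := by
  classical
  obtain ⟨i⟩ := ‹Nonempty n›
  refine ⟨Matrix.vecMulVec (Pi.single i 1) (star (Pi.single i 1)),
    Matrix.posSemidef_vecMulVec_self_star _, ?_⟩
  simp [Matrix.trace, Matrix.vecMulVec_apply, Pi.single_apply]

/-- A positive operator is a nonnegative multiple of a state. -/
theorem Matrix.PosSemidef.exists_isState_smul [Nonempty n] {A : Matrix n n ℂ} (hA : A.PosSemidef) :
    ∃ ρ : Matrix n n ℂ, IsState ρ ∧ A = ((A.trace.re : ℝ) : ℂ) • ρ := by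
  have htr : ((A.trace.re : ℝ) : ℂ) = A.trace :=
    Complex.ext rfl (Complex.nonneg_iff.1 hA.trace_nonneg).2
  by_cases h : A.trace = 0
  · obtain ⟨ρ, hρ⟩ := exists_isState (n := n)
    exact ⟨ρ, hρ, by rw [hA.trace_eq_zero_iff.1 h]; simp⟩
  · refine ⟨((A.trace.re⁻¹ : ℝ) : ℂ) • A, ⟨hA.real_smul (inv_nonneg.2 hA.re_trace_nonneg), ?_⟩, ?_⟩
    · rw [Matrix.trace_smul, Complex.ofReal_inv, htr, smul_eq_mul, inv_mul_cancel₀ h]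
    · rw [smul_smul, Complex.ofReal_inv, htr, mul_inv_cancel₀ h, one_smul]

end Compactness

/-! ### Compactness of channels and the dual norm on positive operators -/

section Channels

variable {a b r : Type*} [Fintype a] [DecidableEq a] [Fintype b] [Fintype r]

theorem isCompact_setOf_isChannel_ofChoi :
    IsCompact {C : Matrix (b × a) (b × a) ℂ | IsChannel (ofChoi C)} := by
  simp only [isChannel_ofChoi_iff]
  refine (isCompact_setOf_posSemidef_trace_le (Fintype.card a)).of_isClosed_subset ?_
    fun C hC => ⟨hC.1, ?_⟩
  · refine isClosed_setOf_posSemidef.inter ?_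
    have : IsClosed {C : Matrix (b × a) (b × a) ℂ |
        ∀ i j, ∑ p, C (p, i) (p, j) = (1 : Matrix a a ℂ) i j} := by
      simp only [Set.ofPred_forall]
      exact isClosed_iInter fun i => isClosed_iInter fun j =>
        isClosed_eq (by fun_prop) continuous_const
    exact this
  · have : C.trace = Fintype.card a := by
      simp only [Matrix.trace, Matrix.diag, Fintype.sum_prod_type_right, hC.2]
      simp
    rw [this]
    simp

theorem convex_setOf_isChannel_ofChoi :
    Convex ℝ {C : Matrix (b × a) (b × a) ℂ | IsChannel (ofChoi C)} := by
  simp only [isChannel_ofChoi_iff]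
  intro C hC D hD s t hs ht hst
  refine ⟨convex_setOf_posSemidef hC.1 hD.1 hs ht hst, fun i j => ?_⟩
  simp only [Matrix.add_apply, Matrix.smul_apply, Finset.sum_add_distrib, ← Finset.smul_sum,
    hC.2, hD.2]
  rw [← add_smul, hst, one_smul]

theorem exists_isChannel [Nonempty b] : ∃ Φ : Matrix a a ℂ →ₗ[ℂ] Matrix b b ℂ, IsChannel Φ := by
  classical
  obtain ⟨x⟩ := ‹Nonempty b›
  refine ⟨ofChoi (Matrix.diagonal fun p => if p.1 = x then 1 else 0), isChannel_ofChoi_iff.2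
    ⟨Matrix.PosSemidef.diagonal fun p => ?_, fun i j => ?_⟩⟩
  · dsimp only
    split_ifs <;> simp
  · simp [Matrix.diagonal_apply, Matrix.one_apply]

omit [DecidableEq a] in
theorem continuous_pairing_ofChoi (X : Matrix (a × r) (a × r) ℂ) :
    Continuous fun C : Matrix (r × a) (r × a) ℂ => pairing X (ofChoi C) := by
  simp only [pairing_ofChoi]
  fun_prop

/-- On positive operators the dual diamond norm is a maximum over channels. -/
theorem exists_isChannel_dualDiamondNorm_eq [Nonempty r] {X : Matrix (a × r) (a × r) ℂ}
    (hX : X.PosSemidef) : ∃ α : Matrix a a ℂ →ₗ[ℂ] Matrix r r ℂ, IsChannel α ∧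
      dualDiamondNorm X = pairing X α ∧ ∀ β, IsChannel β → pairing X β ≤ dualDiamondNorm X := by
  obtain ⟨α₀, hα₀⟩ := exists_isChannel (a := a) (b := r)
  obtain ⟨C, hC, hmax⟩ := (isCompact_setOf_isChannel_ofChoi (a := a) (b := r)).exists_isMaxOn
    ⟨choi α₀, by simpa only [Set.mem_ofPred_eq, ofChoi_choi]⟩
    (continuous_pairing_ofChoi X).continuousOn
  have hmax' : ∀ β, IsChannel β → pairing X β ≤ pairing X (ofChoi C) := fun β hβ => by
    have := hmax (a := choi β) (by simpa only [Set.mem_ofPred_eq, ofChoi_choi])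
    simpa only [Set.mem_ofPred_eq, ofChoi_choi] using this
  have hgreat : IsGreatest {x | ∃ ψ α : Matrix a a ℂ →ₗ[ℂ] Matrix r r ℂ,
      IsChannel α ∧ IsCP (α - ψ) ∧ IsCP (α + ψ) ∧ x = pairing X ψ} (pairing X (ofChoi C)) := by
    refine ⟨⟨ofChoi C, ofChoi C, hC, ?_, hC.1.add hC.1, rfl⟩, ?_⟩
    · rw [sub_self]
      intro k Y _
      exact Matrix.PosSemidef.zero
    -- Since `X` is positive and `ψ ≤ α`, replacing `ψ` by `α` can only increase the pairing.
    · rintro x ⟨ψ, α, hα, h1, -, rfl⟩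
      have := pairing_nonneg hX h1
      rw [pairing_sub] at this
      linarith [hmax' α hα]
  exact ⟨ofChoi C, hC, hgreat.csSup_eq, fun β hβ => (hmax' β hβ).trans hgreat.csSup_eq.ge⟩

end Channels

theorem Matrix.IsHermitian.posSemidef_of_forall_isState {n : Type*} [Fintype n] [Nonempty n]
    {Z : Matrix n n ℂ} (hZ : Z.IsHermitian) (h : ∀ ρ, IsState ρ → 0 ≤ (Z * ρ).trace.re) :
    Z.PosSemidef := by
  classical
  refine Matrix.PosSemidef.of_dotProduct_mulVec_nonneg hZ fun x => ?_
  have hx : (Z * Matrix.vecMulVec x (star x)).trace = star x ⬝ᵥ (Z *ᵥ x) := by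
    rw [Matrix.mul_vecMulVec, Matrix.trace_vecMulVec, dotProduct_comm]
  rw [Complex.nonneg_iff]
  constructor
  · obtain ⟨ρ, hρ, hρx⟩ := (Matrix.posSemidef_vecMulVec_self_star x).exists_isState_smul
    rw [← hx, hρx, Matrix.mul_smul, Matrix.trace_smul, smul_eq_mul, Complex.re_ofReal_mul]
    exact mul_nonneg (Matrix.posSemidef_vecMulVec_self_star x).re_trace_nonneg (h ρ hρ)
  · exact (hZ.im_star_dotProduct_mulVec_self x).symm

/-! ### The diamond norm as domination by a channel -/

section DiamondNorm

variable {a b : Type*} [Fintype a] [DecidableEq a] [Fintype b] [DecidableEq b]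

theorem traceNorm_nonneg {n : Type*} [Fintype n] [DecidableEq n] (X : Matrix n n ℂ) :
    0 ≤ traceNorm X :=
  (CFC.abs_nonneg X).posSemidef.re_trace_nonneg

theorem diamondNorm_nonneg (Φ : Matrix a a ℂ →ₗ[ℂ] Matrix b b ℂ) : 0 ≤ diamondNorm Φ := by
  refine Real.sSup_nonneg ?_
  rintro x ⟨ρ, -, rfl⟩
  exact traceNorm_nonneg _

theorem IsState.re_trace {n : Type*} [Fintype n] {ρ : Matrix n n ℂ} (hρ : IsState ρ) :
    ρ.trace.re = 1 := by rw [hρ.2, Complex.one_re]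

theorem diamondNorm_sub_comm (Φ Ψ : Matrix a a ℂ →ₗ[ℂ] Matrix b b ℂ) :
    diamondNorm (Φ - Ψ) = diamondNorm (Ψ - Φ) := by
  unfold diamondNorm
  congr! 5 with x ρ
  rw [← traceNorm_neg, tensorId_sub, tensorId_sub, neg_sub]

theorem traceNorm_tensorId_le_diamondNorm {Φ Ψ : Matrix a a ℂ →ₗ[ℂ] Matrix b b ℂ}
    (hΦ : IsChannel Φ) (hΨ : IsChannel Ψ) {ρ : Matrix (a × a) (a × a) ℂ} (hρ : IsState ρ) :
    traceNorm (tensorId (Φ - Ψ) a ρ) ≤ diamondNorm (Φ - Ψ) := by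
  refine le_csSup ⟨2, ?_⟩ ⟨ρ, hρ, rfl⟩
  rintro x ⟨τ, hτ, rfl⟩
  rw [tensorId_sub]
  have h1 := hΦ.isState_tensorId hτ
  have h2 := hΨ.isState_tensorId hτ
  have := traceNorm_sub_le h1.1 h2.1
  rw [h1.re_trace, h2.re_trace] at this
  linarith

/-- If `Ψ - Φ ≤ (t / 2) β` for a channel `β`, then `Φ` and `Ψ` are at distance at most `t`. -/
theorem diamondNorm_sub_le {Φ Ψ β : Matrix a a ℂ →ₗ[ℂ] Matrix b b ℂ} {t : ℝ} (ht : 0 ≤ t)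
    (hΦ : IsChannel Φ) (hΨ : IsChannel Ψ) (hβ : IsChannel β)
    (h : IsCP (((t / 2 : ℝ) : ℂ) • β - (Ψ - Φ))) : diamondNorm (Φ - Ψ) ≤ t := by
  refine Real.sSup_le ?_ ht
  rintro x ⟨ρ, hρ, rfl⟩
  -- The output is a difference of two positive operators, each of trace `t / 2`.
  have e : tensorId (Φ - Ψ) a ρ = tensorId (((t / 2 : ℝ) : ℂ) • β - (Ψ - Φ)) a ρ -
      ((t / 2 : ℝ) : ℂ) • tensorId β a ρ := by
    simp only [tensorId_sub, tensorId_smul]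
    abel
  have h1 := hβ.isState_tensorId hρ
  have hle := traceNorm_sub_le (h.tensorId_posSemidef hρ.1)
    (h1.1.real_smul (c := t / 2) (by positivity))
  rw [← e] at hle
  refine hle.trans_eq ?_
  simp only [tensorId_sub, tensorId_smul, Matrix.trace_sub, Matrix.trace_smul, h1.2,
    (hΦ.isState_tensorId hρ).2, (hΨ.isState_tensorId hρ).2]
  simp

omit [DecidableEq b] in
theorem isHermitian_choi_sub {Φ Ψ : Matrix a a ℂ →ₗ[ℂ] Matrix b b ℂ}
    (hΦ : IsCP Φ) (hΨ : IsCP Ψ) : (choi (Φ - Ψ)).IsHermitian := by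
  rw [choi_sub]
  exact (isCP_iff_choi_posSemidef.1 hΦ).isHermitian.sub (isCP_iff_choi_posSemidef.1 hΨ).isHermitian

/-- For `s = √σ` the vector is a purification of `σ`, so the diamond norm controls the Choi matrix
conjugated by `1 ⊗ √σ`. -/
theorem tensorId_vecMulVec (Φ : Matrix a a ℂ →ₗ[ℂ] Matrix b b ℂ) (s : Matrix a a ℂ) :
    tensorId Φ a (Matrix.vecMulVec (fun p => s p.2 p.1) (star fun p : a × a => s p.2 p.1)) =
      ((1 : Matrix b b ℂ) ⊗ₖ s) * choi Φ * ((1 : Matrix b b ℂ) ⊗ₖ s)ᴴ := by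
  ext p q
  conv_lhs => rw [← ofChoi_choi Φ]
  simp only [tensorId_apply, ofChoi_apply, Matrix.of_apply, Matrix.vecMulVec_apply, Pi.star_apply,
    Matrix.mul_apply, Matrix.conjTranspose_apply, Matrix.kroneckerMap_apply,
    Fintype.sum_prod_type, Matrix.one_apply, ite_mul, one_mul, zero_mul, Finset.sum_ite_irrel,
    Finset.sum_const_zero, Finset.sum_ite_eq, Finset.mem_univ, if_true, apply_ite star, star_zero,
    mul_ite, mul_zero, Finset.sum_mul]
  rw [Finset.sum_comm]
  exact Finset.sum_congr rfl fun i _ => Finset.sum_congr rfl fun j _ => by ring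

omit [DecidableEq a] [DecidableEq b] in
theorem re_trace_tensorId_sub {Φ Ψ : Matrix a a ℂ →ₗ[ℂ] Matrix b b ℂ}
    (hΦ : IsChannel Φ) (hΨ : IsChannel Ψ) (ρ : Matrix (a × a) (a × a) ℂ) :
    (tensorId (Φ - Ψ) a ρ).trace.re = 0 := by
  rw [tensorId_sub, Matrix.trace_sub, trace_tensorId hΦ.2, trace_tensorId hΨ.2, sub_self,
    Complex.zero_re]

/-- A dominating operator for the Choi matrix that is cheap when measured against a given positive
definite operator. -/
theorem exists_posSemidef_ge_choi_of_posDef [Nonempty a] {Φ Ψ : Matrix a a ℂ →ₗ[ℂ] Matrix b b ℂ}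
    (hΦ : IsChannel Φ) (hΨ : IsChannel Ψ) {σ : Matrix a a ℂ} (hσ : σ.PosDef) :
    ∃ P : Matrix (b × a) (b × a) ℂ, P.PosSemidef ∧ (P - choi (Φ - Ψ)).PosSemidef ∧
      (P * ((1 : Matrix b b ℂ) ⊗ₖ σ)).trace.re ≤ diamondNorm (Φ - Ψ) / 2 * σ.trace.re := by
  set s := CFC.sqrt σ
  have hss : s * s = σ := CFC.sqrt_mul_sqrt_self σ hσ.posSemidef.nonneg
  have hsh : sᴴ = s := (CFC.sqrt_nonneg σ).posSemidef.isHermitian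
  have hsu : IsUnit s := by
    have : IsUnit (s * s) := hss ▸ hσ.isUnit
    exact isUnit_of_mul_isUnit_left this
  set v : a × a → ℂ := fun p => s p.2 p.1
  obtain ⟨ρ, hρ, hvρ⟩ := (Matrix.posSemidef_vecMulVec_self_star v).exists_isState_smul
  have htr : (Matrix.vecMulVec v (star v)).trace = σ.trace := by
    rw [← hss]
    nth_rw 2 [← hsh]
    simp [Matrix.trace, Matrix.vecMulVec_apply, v, Matrix.mul_apply, Fintype.sum_prod_type_right]
  rw [htr] at hvρ
  have hherm : (tensorId (Φ - Ψ) a ρ).IsHermitian :=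
    (hΦ.isState_tensorId hρ).1.isHermitian.sub (hΨ.isState_tensorId hρ).1.isHermitian
  obtain ⟨Q, hQ, hQX, hQtr⟩ := exists_posSemidef_trace_eq_traceNorm hherm
  -- The output has trace zero, so its positive part `Q` has exactly half of the trace norm.
  rw [re_trace_tensorId_sub hΦ hΨ, add_zero] at hQtr
  set S := (1 : Matrix b b ℂ) ⊗ₖ s with hS
  have hSS : S * ((1 : Matrix b b ℂ) ⊗ₖ s) = (1 : Matrix b b ℂ) ⊗ₖ σ := by
    rw [hS, ← Matrix.mul_kronecker_mul, hss, one_mul]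
  have hSh : Sᴴ = S := by
    rw [hS, Matrix.conjTranspose_kronecker, Matrix.conjTranspose_one, hsh]
  have hdet : IsUnit S.det := (Matrix.isUnit_iff_isUnit_det _).1 (isUnit_one.kronecker hsu)
  have hσ0 : 0 ≤ σ.trace.re := hσ.posSemidef.re_trace_nonneg
  have hC : S * choi (Φ - Ψ) * S = ((σ.trace.re : ℝ) : ℂ) • tensorId (Φ - Ψ) a ρ := by
    rw [← map_smul, ← hvρ, tensorId_vecMulVec, ← hS, hSh]
  have hSih : (S⁻¹)ᴴ = S⁻¹ := by rw [Matrix.conjTranspose_nonsing_inv, hSh]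
  have key : S⁻¹ * (S * choi (Φ - Ψ) * S) * S⁻¹ = choi (Φ - Ψ) := by
    rw [Matrix.mul_assoc S, Matrix.nonsing_inv_mul_cancel_left _ _ hdet,
      Matrix.mul_nonsing_inv_cancel_right _ _ hdet]
  -- Undoing the conjugation by `S` carries `Q` to an operator above the Choi matrix; its trace
  -- against `1 ⊗ σ = S S` is `tr σ · tr Q`.
  refine ⟨S⁻¹ * (((σ.trace.re : ℝ) : ℂ) • Q) * S⁻¹, ?_, ?_, ?_⟩
  · have := (hQ.real_smul hσ0).mul_mul_conjTranspose_same S⁻¹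
    rwa [hSih] at this
  · have := (hQX.real_smul hσ0).mul_mul_conjTranspose_same S⁻¹
    rwa [hSih, smul_sub, ← hC, mul_sub, sub_mul, key] at this
  · have hcancel : S⁻¹ * (((σ.trace.re : ℝ) : ℂ) • Q) * S⁻¹ * (S * S) =
        S⁻¹ * (((σ.trace.re : ℝ) : ℂ) • Q) * S := by
      rw [← Matrix.mul_assoc, Matrix.nonsing_inv_mul_cancel_right _ _ hdet]
    rw [← hSS, ← hS, hcancel, Matrix.trace_mul_comm, Matrix.mul_nonsing_inv_cancel_left _ _ hdet,
      Matrix.trace_smul, smul_eq_mul, Complex.re_ofReal_mul, hQtr, mul_comm]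
    gcongr
    exact traceNorm_tensorId_le_diamondNorm hΦ hΨ hρ

/-- Minimax exchanges the choice of `P` with that of `σ`. Shifting `σ` to `σ + η 1` makes it
positive definite and bounds the trace of `P` by `K / η`, which gives the compactness that minimax
needs. -/
theorem exists_posSemidef_ge_choi [Nonempty a] {Φ Ψ : Matrix a a ℂ →ₗ[ℂ] Matrix b b ℂ}
    (hΦ : IsChannel Φ) (hΨ : IsChannel Ψ) {η : ℝ} (hη : 0 < η) :
    ∃ P : Matrix (b × a) (b × a) ℂ, P.PosSemidef ∧ (P - choi (Φ - Ψ)).PosSemidef ∧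
      ∀ σ : Matrix a a ℂ, IsState σ → (P * ((1 : Matrix b b ℂ) ⊗ₖ σ)).trace.re ≤
        diamondNorm (Φ - Ψ) / 2 * (1 + η * Fintype.card a) := by
  set K := diamondNorm (Φ - Ψ) / 2 * (1 + η * Fintype.card a) with hK
  have hkron : Continuous fun σ : Matrix a a ℂ => (1 : Matrix b b ℂ) ⊗ₖ σ :=
    continuous_matrix fun p q => by
      simp only [Matrix.kroneckerMap_apply]
      fun_prop
  have hcl : IsClosed {P : Matrix (b × a) (b × a) ℂ | (P - choi (Φ - Ψ)).PosSemidef} :=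
    isClosed_setOf_posSemidef.preimage (continuous_id.sub continuous_const)
  have hconv : ∀ (D : Matrix (b × a) (b × a) ℂ),
      Convex ℝ {P : Matrix (b × a) (b × a) ℂ | (P - D).PosSemidef} := fun D => by
    have := (convex_setOf_posSemidef (n := b × a)).translate_preimage_left (-D)
    simp only [← sub_eq_add_neg] at this
    exact this
  obtain ⟨P, ⟨⟨hP, -⟩, hPC⟩, hPσ⟩ := exists_forall_le_zero_of_forall_exists
    (X := {P : Matrix (b × a) (b × a) ℂ | P.PosSemidef ∧ P.trace.re ≤ K / η} ∩
      {P | (P - choi (Φ - Ψ)).PosSemidef}) (Y := {σ : Matrix a a ℂ | IsState σ})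
    (f := fun P σ => (P * ((1 : Matrix b b ℂ) ⊗ₖ σ)).trace.re - K)
    (by
      refine Convex.inter (convex_setOf_posSemidef.inter ?_) (hconv _)
      exact convex_halfSpace_le (f := fun P : Matrix (b × a) (b × a) ℂ => P.trace.re)
        ⟨fun P P' => by simp, fun t P => by simp⟩ _)
    ((isCompact_setOf_posSemidef_trace_le _).inter_right hcl)
    convex_setOf_isState isCompact_setOf_isState
    (fun σ => ((Complex.continuous_re.comp
      (continuous_id.matrix_mul continuous_const).matrix_trace).sub continuous_const))
    (fun P => ((Complex.continuous_re.comp (continuous_const.matrix_mul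
      hkron).matrix_trace).sub continuous_const))
    (fun P P' σ s t hst => by
      simp only [add_mul, Matrix.smul_mul, Matrix.trace_add, Matrix.trace_smul, Complex.add_re,
        Complex.smul_re, smul_eq_mul]
      linear_combination K * hst)
    (fun P σ σ' s t hst => by
      simp only [Matrix.kronecker_add, Matrix.kronecker_smul, mul_add, Matrix.mul_smul,
        Matrix.trace_add, Matrix.trace_smul, Complex.add_re, Complex.smul_re, smul_eq_mul]
      linear_combination K * hst)
    exists_isState
    (fun σ hσ => by
      have hpd : (σ + ((η : ℝ) : ℂ) • (1 : Matrix a a ℂ)).PosDef :=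
        Matrix.PosDef.posSemidef_add hσ.1 (Matrix.PosDef.one.smul (by exact_mod_cast hη))
      obtain ⟨P, hP, hPC, hle⟩ := exists_posSemidef_ge_choi_of_posDef hΦ hΨ hpd
      have htr : (σ + ((η : ℝ) : ℂ) • (1 : Matrix a a ℂ)).trace.re = 1 + η * Fintype.card a := by
        simp [Matrix.trace_add, hσ.2, Matrix.trace_smul]
      rw [htr, ← hK, Matrix.kronecker_add, Matrix.kronecker_smul, Matrix.one_kronecker_one, mul_add,
        Matrix.mul_smul, mul_one, Matrix.trace_add, Matrix.trace_smul, Complex.add_re,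
        smul_eq_mul, Complex.re_ofReal_mul] at hle
      have h1 := hP.re_trace_nonneg
      have h2 := hP.re_trace_mul_nonneg (Matrix.PosSemidef.one.kronecker hσ.1)
      refine ⟨P, ⟨⟨hP, ?_⟩, hPC⟩, ?_⟩
      · rw [le_div_iff₀ hη]
        linarith
      · have := mul_nonneg hη.le h1
        linarith)
  exact ⟨P, hP, hPC, fun σ hσ => by linarith [hPσ σ hσ]⟩

/-- The difference of two channels is dominated by a multiple of a channel, with a factor
that exceeds half of the diamond norm as little as one wants. -/
theorem exists_isChannel_ge_sub [Nonempty a] [Nonempty b] {Φ Ψ : Matrix a a ℂ →ₗ[ℂ] Matrix b b ℂ}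
    (hΦ : IsChannel Φ) (hΨ : IsChannel Ψ) {t : ℝ} (ht : diamondNorm (Φ - Ψ) < t) :
    ∃ β : Matrix a a ℂ →ₗ[ℂ] Matrix b b ℂ, IsChannel β ∧
      IsCP (((t / 2 : ℝ) : ℂ) • β - (Φ - Ψ)) := by
  set d := diamondNorm (Φ - Ψ)
  have hd0 : 0 ≤ d := diamondNorm_nonneg _
  have hn : (0 : ℝ) < Fintype.card a := by exact_mod_cast Fintype.card_pos
  set c := t / 2 with hc
  have hc0 : 0 < c := by positivity [hd0.trans_lt ht]
  -- This `η` keeps the bound `d / 2 * (1 + η * card a)` below `t / 2`; the denominator `d + 1`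
  -- avoids a division by zero.
  obtain ⟨P, hP, hPC, hPσ⟩ := exists_posSemidef_ge_choi hΦ hΨ
    (η := (t - d) / ((d + 1) * Fintype.card a)) (by have := sub_pos.2 ht; positivity)
  have hbound : d / 2 * (1 + (t - d) / ((d + 1) * Fintype.card a) * Fintype.card a) ≤ c := by
    have : (t - d) / ((d + 1) * Fintype.card a) * Fintype.card a = (t - d) / (d + 1) := by
      field_simp
    have h2 : d * ((t - d) / (d + 1)) ≤ t - d := by
      rw [mul_div_assoc', div_le_iff₀ (by positivity)]
      nlinarith
    rw [this, hc]
    linarith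
  let T : Matrix a a ℂ := ∑ x : b, P.submatrix (Prod.mk x) (Prod.mk x)
  have hT : T.PosSemidef := Matrix.posSemidef_sum _ fun x _ => hP.submatrix _
  have hTσ : ∀ σ : Matrix a a ℂ,
      (P * ((1 : Matrix b b ℂ) ⊗ₖ σ)).trace = (T * σ).trace := fun σ => by
    simp only [T, Matrix.trace, Matrix.diag, Matrix.mul_apply, Fintype.sum_prod_type,
      Matrix.sum_apply, Matrix.kroneckerMap_apply, Matrix.one_apply, ite_mul, one_mul, zero_mul,
      mul_ite, mul_zero, Finset.sum_ite_irrel, Finset.sum_const_zero, Finset.sum_ite_eq',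
      Finset.mem_univ, if_true, Matrix.submatrix_apply, Finset.sum_mul]
    rw [Finset.sum_comm]
    exact Finset.sum_congr rfl fun i _ => Finset.sum_comm
  have hR : ((c : ℂ) • (1 : Matrix a a ℂ) - T).PosSemidef := by
    refine Matrix.IsHermitian.posSemidef_of_forall_isState
      ((Matrix.PosSemidef.one.real_smul hc0.le).isHermitian.sub hT.isHermitian) fun σ hσ => ?_
    rw [sub_mul, Matrix.smul_mul, one_mul, Matrix.trace_sub, Matrix.trace_smul, hσ.2, ← hTσ]
    simpa using (hPσ σ hσ).trans hbound
  set R := (c : ℂ) • (1 : Matrix a a ℂ) - T with hRdef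
  -- The partial trace `T` of `P` is at most `c 1`. Adding `W`, whose partial trace is the deficit
  -- `R`, makes it exactly `c 1`, so that `c⁻¹ (P + W)` is the Choi matrix of a channel.
  let W : Matrix (b × a) (b × a) ℂ :=
    (((Fintype.card b : ℝ)⁻¹ : ℝ) : ℂ) • ((1 : Matrix b b ℂ) ⊗ₖ R)
  have hWp : W.PosSemidef :=
    (Matrix.PosSemidef.one.kronecker hR).real_smul (inv_nonneg.2 (Nat.cast_nonneg _))
  have hcc : (c : ℂ) ≠ 0 := by exact_mod_cast hc0.ne'
  refine ⟨ofChoi (((c⁻¹ : ℝ) : ℂ) • (P + W)), isChannel_ofChoi_iff.2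
    ⟨(hP.add hWp).real_smul (inv_nonneg.2 hc0.le), fun i j => ?_⟩, ?_⟩
  · have h1 : ∑ x, P (x, i) (x, j) = T i j := by simp [T, Matrix.sum_apply]
    have h2 : ∑ x, W (x, i) (x, j) = R i j := by
      simp [W]
    simp only [Matrix.smul_apply, Matrix.add_apply, ← Finset.smul_sum, Finset.sum_add_distrib, h1,
      h2, hRdef]
    simp [hcc]
  · rw [isCP_iff_choi_posSemidef, choi_sub, choi_smul, choi_ofChoi, smul_smul, Complex.ofReal_inv,
      mul_inv_cancel₀ hcc, one_smul]
    have := hPC.add hWp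
    rwa [sub_add_eq_add_sub] at this

end DiamondNorm

/-! ### Attainment of the deficiency -/

section Deficiency

variable {a₀ a₁ a₁' : Type*} [Fintype a₀] [DecidableEq a₀] [Nonempty a₀] [Fintype a₁]
  [DecidableEq a₁] [Fintype a₁'] [DecidableEq a₁']

theorem IsChannel.nonempty {a b : Type*} [Fintype a] [Nonempty a] [Fintype b]
    {Φ : Matrix a a ℂ →ₗ[ℂ] Matrix b b ℂ} (hΦ : IsChannel Φ) : Nonempty b := by
  by_contra hb
  rw [not_nonempty_iff] at hb
  obtain ⟨ρ, hρ⟩ := exists_isState (n := a)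
  have := (hΦ.2 ρ).trans hρ.2
  simp [Matrix.trace] at this

/-- The deficiency is attained, by a postprocessing whose error is dominated by a channel. -/
theorem exists_isLeast_postDistances {Φ₁ : Matrix a₀ a₀ ℂ →ₗ[ℂ] Matrix a₁ a₁ ℂ}
    (hΦ₁ : IsChannel Φ₁) {Φ₂ : Matrix a₀ a₀ ℂ →ₗ[ℂ] Matrix a₁' a₁' ℂ} (hΦ₂ : IsChannel Φ₂) :
    ∃ (t : ℝ) (Λ : Matrix a₁ a₁ ℂ →ₗ[ℂ] Matrix a₁' a₁' ℂ)
      (β : Matrix a₀ a₀ ℂ →ₗ[ℂ] Matrix a₁' a₁' ℂ),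
      IsChannel Λ ∧ IsChannel β ∧ IsCP (((t / 2 : ℝ) : ℂ) • β - (Φ₂ - Λ ∘ₗ Φ₁)) ∧
      IsLeast (postDistances Φ₁ Φ₂) t := by
  have := hΦ₂.nonempty
  let g : Matrix (a₁' × a₁) (a₁' × a₁) ℂ × Matrix (a₁' × a₀) (a₁' × a₀) ℂ × ℝ →
      Matrix (a₁' × a₀) (a₁' × a₀) ℂ := fun z =>
    ((z.2.2 / 2 : ℝ) : ℂ) • z.2.1 - (choi Φ₂ - choi (ofChoi z.1 ∘ₗ Φ₁))
  have hg : Continuous g := by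
    refine ((Complex.continuous_ofReal.comp (by fun_prop)).smul (by fun_prop)).sub
      (continuous_const.sub (continuous_matrix fun p q => ?_))
    simp only [choi_apply, LinearMap.comp_apply, ofChoi_apply]
    fun_prop
  -- Minimising the coordinate `t` over dominated triples yields the optimal `Λ` and its `β`
  -- together. The range stops at `2`, where `β = Φ₂` always works.
  let S := ({C | IsChannel (ofChoi C)} ×ˢ ({C | IsChannel (ofChoi C)} ×ˢ Set.Icc (0 : ℝ) 2)) ∩
    g ⁻¹' {A | A.PosSemidef}
  have hS : IsCompact S :=
    ((isCompact_setOf_isChannel_ofChoi (a := a₁) (b := a₁')).prod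
      ((isCompact_setOf_isChannel_ofChoi (a := a₀) (b := a₁')).prod
        (isCompact_Icc (a := (0 : ℝ)) (b := 2)))).inter_right
      (isClosed_setOf_posSemidef.preimage hg)
  have hgcp : ∀ Λ β (t : ℝ), (g (choi Λ, choi β, t)).PosSemidef ↔
      IsCP (((t / 2 : ℝ) : ℂ) • β - (Φ₂ - Λ ∘ₗ Φ₁)) := fun Λ β t => by
    rw [isCP_iff_choi_posSemidef]
    simp only [g, ofChoi_choi]
    rfl
  have hmem : ∀ (Λ : Matrix a₁ a₁ ℂ →ₗ[ℂ] Matrix a₁' a₁' ℂ)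
      (β : Matrix a₀ a₀ ℂ →ₗ[ℂ] Matrix a₁' a₁' ℂ) (t : ℝ), IsChannel Λ → IsChannel β →
      t ∈ Set.Icc (0 : ℝ) 2 → IsCP (((t / 2 : ℝ) : ℂ) • β - (Φ₂ - Λ ∘ₗ Φ₁)) →
      (choi Λ, choi β, t) ∈ S := fun Λ β t hΛ hβ ht h => by
    refine ⟨⟨?_, ?_, ht⟩, (hgcp Λ β t).2 h⟩
    · rwa [Set.mem_ofPred_eq, ofChoi_choi]
    · rwa [Set.mem_ofPred_eq, ofChoi_choi]
  have hne : S.Nonempty := by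
    obtain ⟨Λ, hΛ⟩ := exists_isChannel (a := a₁) (b := a₁')
    refine ⟨_, hmem Λ Φ₂ 2 hΛ hΦ₂ ⟨zero_le_two, le_rfl⟩ ?_⟩
    have : (((2 : ℝ) / 2 : ℝ) : ℂ) • Φ₂ - (Φ₂ - Λ ∘ₗ Φ₁) = Λ ∘ₗ Φ₁ := by simp
    rw [this]
    exact (hΛ.comp hΦ₁).1
  obtain ⟨⟨C, D, t⟩, ⟨⟨hC, hD, ht⟩, hCDt⟩, hmin⟩ := hS.exists_isMinOn (f := fun z => z.2.2) hne
    (by fun_prop)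
  have hcp : IsCP (((t / 2 : ℝ) : ℂ) • ofChoi D - (Φ₂ - ofChoi C ∘ₗ Φ₁)) := by
    rw [← hgcp, choi_ofChoi, choi_ofChoi]
    exact hCDt
  have hle : ∀ Λ, IsChannel Λ → t ≤ diamondNorm (Λ ∘ₗ Φ₁ - Φ₂) := fun Λ hΛ => by
    -- Domination is available only for factors strictly above the norm, so `s` approaches it from
    -- above.
    refine le_of_forall_gt_imp_ge_of_dense fun s hs => ?_
    rcases le_or_gt s 2 with hs2 | hs2
    · have hs' : diamondNorm (Φ₂ - Λ ∘ₗ Φ₁) < s := by rwa [diamondNorm_sub_comm]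
      obtain ⟨β, hβ, hβcp⟩ := exists_isChannel_ge_sub hΦ₂ (hΛ.comp hΦ₁) hs'
      exact hmin (hmem Λ β s hΛ hβ ⟨(diamondNorm_nonneg _).trans hs.le, hs2⟩ hβcp)
    · exact ht.2.trans hs2.le
  refine ⟨t, ofChoi C, ofChoi D, hC, hD, hcp, ⟨ofChoi C, hC, ?_⟩, ?_⟩
  · exact (hle _ hC).antisymm
      (diamondNorm_sub_le ht.1 (IsChannel.comp hC hΦ₁) hΦ₂ hD hcp)
  · rintro x ⟨Λ, hΛ, rfl⟩
    exact hle Λ hΛ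

end Deficiency

/-! ### Guessing probabilities under channels -/

section Guessing

variable {a b r : Type*} [Fintype a] [DecidableEq a] [Fintype b] [DecidableEq b] [Fintype r]
  [DecidableEq r]

/-- Measurements can be pulled back along `β ⊗ id_r` for a channel `β`. -/
theorem IsChannel.exists_pullback_measurement {β : Matrix a a ℂ →ₗ[ℂ] Matrix b b ℂ}
    (hβ : IsChannel β) {k : ℕ} {M : Fin k → Matrix (b × r) (b × r) ℂ} (hM : IsMeasurement M) :
    ∃ M' : Fin k → Matrix (a × r) (a × r) ℂ, IsMeasurement M' ∧
      ∀ i X, (tensorId β r X * M i).trace = (X * M' i).trace := by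
  obtain ⟨C, rfl⟩ : ∃ C, β = ofChoi C := ⟨_, (ofChoi_choi β).symm⟩
  obtain ⟨hC, htr⟩ := isChannel_ofChoi_iff.1 hβ
  -- The adjoint of `β` for the trace pairing; it is unital because `β` preserves the trace.
  let β' : Matrix b b ℂ →ₗ[ℂ] Matrix a a ℂ := ofChoi (Cᵀ.submatrix Prod.swap Prod.swap)
  refine ⟨fun i => tensorId β' r (M i), ⟨fun i =>
    tensorId_ofChoi_posSemidef (hC.transpose.submatrix _) (hM.1 i), ?_⟩, fun i X => ?_⟩
  · rw [← map_sum, hM.2]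
    ext p q
    simp only [tensorId_apply, β', ofChoi_apply, Matrix.of_apply, Matrix.one_apply, Prod.ext_iff,
      Matrix.submatrix_apply, Matrix.transpose_apply, Prod.swap]
    by_cases h : p.2 = q.2
    · simp [h, htr, Matrix.one_apply, eq_comm]
    · simp [h]
  · simp only [Matrix.trace, Matrix.diag, Matrix.mul_apply, tensorId_apply, β', ofChoi_apply,
      Matrix.of_apply, Matrix.submatrix_apply, Matrix.transpose_apply, Prod.swap, Finset.sum_mul,
      Finset.mul_sum]
    simp only [Fintype.sum_prod_type_right]
    refine Finset.sum_congr rfl fun x _ => ?_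
    rw [Finset.sum_comm]
    conv_rhs => rw [Finset.sum_comm]
    refine Finset.sum_congr rfl fun y _ => ?_
    rw [sum_sum_sum_sum_comm]
    refine Finset.sum_congr rfl fun i _ => Finset.sum_congr rfl fun j _ => ?_
    rw [Finset.sum_comm]
    exact Finset.sum_congr rfl fun l _ => Finset.sum_congr rfl fun m _ => by ring

theorem IsMeasurement.posSemidef_one_sub {k : ℕ} {M : Fin k → Matrix a a ℂ}
    (hM : IsMeasurement M) (i : Fin k) : (1 - M i).PosSemidef := by
  rw [← hM.2, ← Finset.add_sum_erase _ _ (Finset.mem_univ i), add_sub_cancel_left]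
  exact Matrix.posSemidef_sum _ fun j _ => hM.1 j

theorem le_guessProb {k : ℕ} {p : Fin k → ℝ} {ρ : Fin k → Matrix a a ℂ} (h : IsEnsemble p ρ)
    {M : Fin k → Matrix a a ℂ} (hM : IsMeasurement M) :
    ∑ i, p i * (ρ i * M i).trace.re ≤ guessProb p ρ := by
  refine le_csSup ⟨1, ?_⟩ ⟨M, hM, rfl⟩
  rintro x ⟨N, hN, rfl⟩
  rw [← h.2.1]
  refine Finset.sum_le_sum fun i _ => mul_le_of_le_one_right (h.1 i) ?_
  have := (h.2.2 i).1.re_trace_mul_nonneg (hN.posSemidef_one_sub i)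
  rw [mul_sub, mul_one, Matrix.trace_sub, Complex.sub_re, (h.2.2 i).re_trace] at this
  linarith

theorem guessProb_nonneg {k : ℕ} {p : Fin k → ℝ} {ρ : Fin k → Matrix a a ℂ}
    (h : IsEnsemble p ρ) : 0 ≤ guessProb p ρ := by
  refine Real.sSup_nonneg ?_
  rintro x ⟨M, hM, rfl⟩
  exact Finset.sum_nonneg fun i _ =>
    mul_nonneg (h.1 i) ((h.2.2 i).1.re_trace_mul_nonneg (hM.1 i))

omit [DecidableEq a] [DecidableEq b] [DecidableEq r] in
theorem IsChannel.isEnsemble_tensorId {Φ : Matrix a a ℂ →ₗ[ℂ] Matrix b b ℂ} (hΦ : IsChannel Φ)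
    {k : ℕ} {p : Fin k → ℝ} {ρ : Fin k → Matrix (a × r) (a × r) ℂ} (h : IsEnsemble p ρ) :
    IsEnsemble p fun i => tensorId Φ r (ρ i) :=
  ⟨h.1, h.2.1, fun i => hΦ.isState_tensorId (h.2.2 i)⟩

/-- A channel on the first system cannot increase the guessing probability. -/
theorem sum_trace_tensorId_le_guessProb {β : Matrix a a ℂ →ₗ[ℂ] Matrix b b ℂ} (hβ : IsChannel β)
    {k : ℕ} {p : Fin k → ℝ} {ρ : Fin k → Matrix (a × r) (a × r) ℂ} (h : IsEnsemble p ρ)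
    {M : Fin k → Matrix (b × r) (b × r) ℂ} (hM : IsMeasurement M) :
    ∑ i, p i * (tensorId β r (ρ i) * M i).trace.re ≤ guessProb p ρ := by
  obtain ⟨M', hM', htr⟩ := hβ.exists_pullback_measurement hM
  simp only [htr]
  exact le_guessProb h hM'

end Guessing

/-! ### Twirling the ancilla by signed permutations -/

section SignedPermutations

variable {a b r : Type*}

/-- Conjugation of the second system by the signed permutation matrix given by `g`. -/
def signedPermConj (g : (r → ℤˣ) × Equiv.Perm r) (X : Matrix (a × r) (a × r) ℂ) :
    Matrix (a × r) (a × r) ℂ :=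
  Matrix.of fun p q => ((g.1 p.2 : ℤ) : ℂ) * ((g.1 q.2 : ℤ) : ℂ) *
    X (p.1, g.2 p.2) (q.1, g.2 q.2)

theorem units_int_mul_self (u : ℤˣ) : ((u : ℤ) : ℂ) * ((u : ℤ) : ℂ) = 1 := by
  rw [← Int.cast_mul, ← Units.val_mul, Int.units_mul_self, Units.val_one, Int.cast_one]

theorem signedPermConj_apply (g : (r → ℤˣ) × Equiv.Perm r) (X : Matrix (a × r) (a × r) ℂ)
    (p q : a × r) : signedPermConj g X p q = ((g.1 p.2 : ℤ) : ℂ) * ((g.1 q.2 : ℤ) : ℂ) *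
      X (p.1, g.2 p.2) (q.1, g.2 q.2) := rfl

theorem signedPermConj_inverse (g : (r → ℤˣ) × Equiv.Perm r) (X : Matrix (a × r) (a × r) ℂ) :
    signedPermConj g (signedPermConj (g.1 ∘ g.2.symm, g.2.symm) X) = X := by
  ext p q
  simp only [signedPermConj_apply, Function.comp_apply, Equiv.symm_apply_apply]
  linear_combination (((g.1 q.2 : ℤ) : ℂ) * ((g.1 q.2 : ℤ) : ℂ) * X p q) *
    units_int_mul_self (g.1 p.2) + X p q * units_int_mul_self (g.1 q.2)

theorem tensorId_signedPermConj (Φ : Matrix a a ℂ →ₗ[ℂ] Matrix b b ℂ)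
    (g : (r → ℤˣ) × Equiv.Perm r) (X : Matrix (a × r) (a × r) ℂ) :
    tensorId Φ r (signedPermConj g X) = signedPermConj g (tensorId Φ r X) := by
  ext p q
  simp only [tensorId_apply, signedPermConj_apply]
  have : (Matrix.of fun i j => ((g.1 p.2 : ℤ) : ℂ) * ((g.1 q.2 : ℤ) : ℂ) *
      X (i, g.2 p.2) (j, g.2 q.2)) = (((g.1 p.2 : ℤ) : ℂ) * ((g.1 q.2 : ℤ) : ℂ)) •
        Matrix.of fun i j => X (i, g.2 p.2) (j, g.2 q.2) := rfl
  rw [this, map_smul]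
  rfl

theorem sum_signedPermConj_diag [Fintype r] (g : (r → ℤˣ) × Equiv.Perm r)
    (X : Matrix (a × r) (a × r) ℂ) (i j : a) :
    ∑ x, signedPermConj g X (i, x) (j, x) = ∑ x, X (i, x) (j, x) := by
  simp only [signedPermConj_apply, units_int_mul_self, one_mul]
  exact Equiv.sum_comp g.2 fun x => X (i, x) (j, x)

theorem trace_signedPermConj [Fintype a] [Fintype r] (g : (r → ℤˣ) × Equiv.Perm r)
    (X : Matrix (a × r) (a × r) ℂ) : (signedPermConj g X).trace = X.trace := by
  simp only [Matrix.trace, Matrix.diag, Fintype.sum_prod_type, sum_signedPermConj_diag]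

theorem signedPermConj_mul [Fintype a] [Fintype r] (g : (r → ℤˣ) × Equiv.Perm r)
    (X Y : Matrix (a × r) (a × r) ℂ) :
    signedPermConj g X * signedPermConj g Y = signedPermConj g (X * Y) := by
  ext p q
  simp only [Matrix.mul_apply, signedPermConj_apply, Finset.mul_sum, Fintype.sum_prod_type]
  refine Finset.sum_congr rfl fun i _ => ?_
  refine (Finset.sum_congr rfl fun x _ => ?_).trans (Equiv.sum_comp g.2 fun x =>
    ((g.1 p.2 : ℤ) : ℂ) * ((g.1 q.2 : ℤ) : ℂ) * (X (p.1, g.2 p.2) (i, x) * Y (i, x) (q.1, g.2 q.2)))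
  linear_combination (((g.1 p.2 : ℤ) : ℂ) * ((g.1 q.2 : ℤ) : ℂ) * X (p.1, g.2 p.2) (i, g.2 x) *
    Y (i, g.2 x) (q.1, g.2 q.2)) * units_int_mul_self (g.1 x)

theorem Matrix.PosSemidef.signedPermConj [Fintype a] [Fintype r] {X : Matrix (a × r) (a × r) ℂ}
    (hX : X.PosSemidef) (g : (r → ℤˣ) × Equiv.Perm r) : (signedPermConj g X).PosSemidef := by
  classical
  have := (hX.submatrix (Prod.map id g.2)).mul_mul_conjTranspose_same
    (Matrix.diagonal fun p : a × r => ((g.1 p.2 : ℤ) : ℂ))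
  convert this using 1
  ext p q
  simp [signedPermConj_apply, Matrix.diagonal_conjTranspose, Matrix.diagonal_mul,
    Matrix.mul_diagonal, Prod.map]
  ring

theorem IsState.signedPermConj [Fintype a] [Fintype r] {X : Matrix (a × r) (a × r) ℂ}
    (hX : IsState X) (g : (r → ℤˣ) × Equiv.Perm r) : IsState (signedPermConj g X) :=
  ⟨hX.1.signedPermConj g, (trace_signedPermConj g X).trans hX.2⟩

/-- Right multiplication by a transposition shows that the sum over permutations does not depend on
the point `x`; averaging over points gives the value. -/
theorem card_mul_sum_perm [Fintype r] [DecidableEq r] (F : r → ℂ) (x : r) :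
    (Fintype.card r : ℂ) * ∑ π : Equiv.Perm r, F (π x) =
      Fintype.card (Equiv.Perm r) * ∑ y, F y := by
  have h : ∀ y, ∑ π : Equiv.Perm r, F (π y) = ∑ π : Equiv.Perm r, F (π x) := fun y => by
    rw [← Equiv.sum_comp (Equiv.mulRight (Equiv.swap x y))]
    simp
  calc _ = ∑ y, ∑ π : Equiv.Perm r, F (π y) := by simp [h]
    _ = ∑ π : Equiv.Perm r, ∑ y, F (π y) := Finset.sum_comm
    _ = ∑ π : Equiv.Perm r, ∑ y, F y := Finset.sum_congr rfl fun π _ => Equiv.sum_comp π F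
    _ = _ := by simp

/-- Flipping the sign at `x` alone negates the sum. -/
theorem sum_sign_mul_sign [Fintype r] [DecidableEq r] {x y : r} (h : x ≠ y) :
    ∑ s : r → ℤˣ, ((s x : ℤ) : ℂ) * ((s y : ℤ) : ℂ) = 0 := by
  have := Equiv.sum_comp (Equiv.mulLeft (Function.update (1 : r → ℤˣ) x (-1)))
    fun s : r → ℤˣ => ((s x : ℤ) : ℂ) * ((s y : ℤ) : ℂ)
  simp only [Equiv.coe_mulLeft, Pi.mul_apply, Function.update_self, Function.update_of_ne h.symm,
    Pi.one_apply, one_mul, neg_mul, Units.val_neg, Int.cast_neg, Finset.sum_neg_distrib] at this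
  exact self_eq_neg.1 this.symm

/-- The average over the signed permutations is the partial trace. -/
theorem sum_signedPermConj [Fintype r] [DecidableEq r] [Nonempty r] [DecidableEq a]
    {N : Matrix (a × r) (a × r) ℂ} (hN : ∀ i j, ∑ x, N (i, x) (j, x) = (1 : Matrix a a ℂ) i j) :
    ∑ g : (r → ℤˣ) × Equiv.Perm r, signedPermConj g N =
      ((Fintype.card ((r → ℤˣ) × Equiv.Perm r) / Fintype.card r : ℝ) : ℂ) • 1 := by
  have hn : (Fintype.card r : ℂ) ≠ 0 := by exact_mod_cast Fintype.card_ne_zero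
  ext ⟨i, x⟩ ⟨j, y⟩
  simp only [Matrix.sum_apply, signedPermConj_apply, Fintype.sum_prod_type, Matrix.smul_apply]
  -- In the diagonal blocks the signs square to one and the permutations average; the off-diagonal
  -- blocks are cancelled by the signs.
  by_cases hxy : x = y
  · subst hxy
    have := card_mul_sum_perm (fun y => N (i, y) (j, y)) x
    rw [hN] at this
    simp only [units_int_mul_self, one_mul, Finset.sum_const, Finset.card_univ, nsmul_eq_mul,
      Fintype.card_prod, smul_eq_mul]
    have h1 : (1 : Matrix (a × r) (a × r) ℂ) (i, x) (j, x) = (1 : Matrix a a ℂ) i j := by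
      simp [Matrix.one_apply]
    rw [h1]
    push_cast
    field_simp
    linear_combination this
  · rw [Finset.sum_comm]
    simp only [← Finset.sum_mul, sum_sign_mul_sign hxy, zero_mul, Finset.sum_const_zero]
    simp [hxy]

theorem isChannel_ofChoi_transpose_swap [Fintype a] [DecidableEq a] [Fintype r]
    {N : Matrix (a × r) (a × r) ℂ} :
    IsChannel (ofChoi (Nᵀ.submatrix Prod.swap Prod.swap)) ↔
      N.PosSemidef ∧ ∀ i j, ∑ x, N (i, x) (j, x) = (1 : Matrix a a ℂ) i j := by
  rw [isChannel_ofChoi_iff]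
  refine and_congr ?_ ?_
  · rw [← Matrix.posSemidef_transpose_iff (M := N)]
    exact Matrix.posSemidef_submatrix_equiv (Equiv.prodComm r a)
  · rw [forall_comm]
    simp [Matrix.one_apply, eq_comm]

/-- The guessing probability of the uniform ensemble of all conjugations of a state by signed
permutations is proportional to the dual norm of the state. -/
theorem guessProb_signedPermConj [Fintype a] [DecidableEq a] [Fintype r] [DecidableEq r]
    [Nonempty r] {X : Matrix (a × r) (a × r) ℂ} (hX : IsState X) {k : ℕ}
    (e : Fin k ≃ (r → ℤˣ) × Equiv.Perm r) :
    IsEnsemble (fun _ => (k : ℝ)⁻¹) (fun i => signedPermConj (e i) X) ∧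
    guessProb (fun _ => (k : ℝ)⁻¹) (fun i => signedPermConj (e i) X) =
      Fintype.card r / k * dualDiamondNorm X := by
  have hk : Fintype.card ((r → ℤˣ) × Equiv.Perm r) = k := by
    rw [← Fintype.card_congr e, Fintype.card_fin]
  have hk0 : (0 : ℝ) < k := by
    rw [← hk]
    exact_mod_cast Fintype.card_pos
  have hn0 : (0 : ℝ) < Fintype.card r := by exact_mod_cast Fintype.card_pos
  obtain ⟨α, hα, hαX, hmax⟩ := exists_isChannel_dualDiamondNorm_eq hX.1
  have hens : IsEnsemble (fun _ => (k : ℝ)⁻¹) (fun i => signedPermConj (e i) X) :=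
    ⟨fun _ => inv_nonneg.2 hk0.le, by simp [hk0.ne'], fun i => hX.signedPermConj _⟩
  refine ⟨hens, le_antisymm (Real.sSup_le ?_ ?_) ?_⟩
  · rintro x ⟨M, hM, rfl⟩
    -- Moving the conjugations from the states to the measurement leaves one operator tested against
    -- `X`. The partial traces of the `M i` add up to `card r` times the identity, hence the
    -- normalisation.
    let N : Matrix (a × r) (a × r) ℂ := (((Fintype.card r : ℝ)⁻¹ : ℝ) : ℂ) •
      ∑ i, signedPermConj ((e i).1 ∘ (e i).2.symm, (e i).2.symm) (M i)
    have hN : IsChannel (ofChoi (Nᵀ.submatrix Prod.swap Prod.swap)) := by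
      refine isChannel_ofChoi_transpose_swap.2 ⟨?_, fun i j => ?_⟩
      · exact (Matrix.posSemidef_sum _ fun i _ => (hM.1 i).signedPermConj _).real_smul
          (inv_nonneg.2 hn0.le)
      · have h1 : ∀ x, ∑ l, M l (i, x) (j, x) = (1 : Matrix a a ℂ) i j := fun x => by
          rw [← Matrix.sum_apply, hM.2]
          simp [Matrix.one_apply]
        simp only [N, Matrix.smul_apply, Matrix.sum_apply, ← Finset.smul_sum]
        rw [Finset.sum_comm]
        simp only [sum_signedPermConj_diag]
        rw [Finset.sum_comm]
        simp [h1]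
    have hle := hmax _ hN
    rw [pairing_ofChoi_eq_trace, Matrix.mul_smul, Matrix.trace_smul, smul_eq_mul,
      Complex.re_ofReal_mul, Matrix.mul_sum, Matrix.trace_sum, Complex.re_sum] at hle
    have hterm : ∀ i, (signedPermConj (e i) X * M i).trace =
        (X * signedPermConj ((e i).1 ∘ (e i).2.symm, (e i).2.symm) (M i)).trace := fun i => by
      conv_lhs => rw [← signedPermConj_inverse (e i) (M i)]
      rw [signedPermConj_mul, trace_signedPermConj]
    simp only [hterm, ← Finset.mul_sum]
    rw [inv_mul_le_iff₀ hn0] at hle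
    rw [inv_mul_le_iff₀ hk0]
    refine hle.trans_eq ?_
    field_simp
  · rw [hαX]
    exact mul_nonneg (by positivity) (pairing_nonneg hX.1 hα.1)
  · obtain ⟨N, rfl⟩ : ∃ N : Matrix (a × r) (a × r) ℂ,
        α = ofChoi (Nᵀ.submatrix Prod.swap Prod.swap) := by
      refine ⟨(choi α)ᵀ.submatrix Prod.swap Prod.swap, ?_⟩
      conv_lhs => rw [← ofChoi_choi α]
      rfl
    obtain ⟨hNp, hNtr⟩ := isChannel_ofChoi_transpose_swap.1 hα
    -- Conversely, the conjugates of the optimal `N` form a measurement, since their sum is a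
    -- multiple of the identity.
    have hM : IsMeasurement fun i =>
        ((Fintype.card r / k : ℝ) : ℂ) • signedPermConj (e i) N := by
      refine ⟨fun i => (hNp.signedPermConj _).real_smul (by positivity), ?_⟩
      rw [← Finset.smul_sum, Equiv.sum_comp e fun g => signedPermConj g N, sum_signedPermConj hNtr,
        smul_smul, hk, ← Complex.ofReal_mul, div_mul_div_cancel₀ hk0.ne', div_self hn0.ne',
        Complex.ofReal_one, one_smul]
    refine le_trans (le_of_eq ?_) (le_guessProb hens hM)
    simp only [Matrix.mul_smul, signedPermConj_mul, Matrix.trace_smul, trace_signedPermConj,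
      smul_eq_mul, Complex.re_ofReal_mul, hαX, pairing_ofChoi_eq_trace, Finset.sum_const,
      Finset.card_univ, Fintype.card_fin, nsmul_eq_mul]
    field_simp

end SignedPermutations

/-! ### The implications between the three conditions -/

section Comparison

variable {a b r : Type*}

theorem isChannel_reindex [Fintype a] [Fintype b] (e : a ≃ b) :
    IsChannel (Matrix.reindexLinearEquiv ℂ ℂ e e).toLinearMap :=
  ⟨fun _ _ hX => hX.submatrix (Prod.map e.symm id), fun X =>
    Equiv.sum_comp e.symm fun i => X i i⟩

/-- Pairing with `φ` is the trace against its transposed Choi matrix, and the positive cone is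
self-dual. -/
theorem isCP_of_forall_pairing_nonneg [Fintype a] [DecidableEq a] [Fintype r] [Nonempty a]
    [Nonempty r] {φ : Matrix a a ℂ →ₗ[ℂ] Matrix r r ℂ} (hφ : (choi φ).IsHermitian)
    (h : ∀ ρ, IsState ρ → 0 ≤ pairing ρ φ) : IsCP φ := by
  rw [isCP_iff_choi_posSemidef]
  have hN : ((choi φ)ᵀ.submatrix Prod.swap Prod.swap : Matrix (a × r) (a × r) ℂ).PosSemidef := by
    refine (hφ.transpose.submatrix _).posSemidef_of_forall_isState fun ρ hρ => ?_
    rw [Matrix.trace_mul_comm, ← pairing_ofChoi_eq_trace]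
    change 0 ≤ pairing ρ (ofChoi (choi φ))
    rw [ofChoi_choi]
    exact h ρ hρ
  exact (hN.submatrix Prod.swap).transpose

theorem pairing_smul_add_smul [Fintype a] [Fintype r] (X Y : Matrix (a × r) (a × r) ℂ)
    (s t : ℝ) (φ : Matrix a a ℂ →ₗ[ℂ] Matrix r r ℂ) :
    pairing (s • X + t • Y) φ = s * pairing X φ + t * pairing Y φ := by
  simp only [pairing, map_add, ← Complex.coe_smul, map_smul, Matrix.add_apply, Matrix.smul_apply,
    Finset.sum_add_distrib, smul_eq_mul, ← Finset.mul_sum, Complex.add_re, Complex.re_ofReal_mul]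

theorem pairing_ofChoi_smul_add_smul [Fintype a] [Fintype r] (X : Matrix (a × r) (a × r) ℂ)
    (s t : ℝ) (C D : Matrix (r × a) (r × a) ℂ) :
    pairing X (ofChoi (s • C + t • D)) = s * pairing X (ofChoi C) + t * pairing X (ofChoi D) := by
  rw [map_add, ← Complex.coe_smul, ← Complex.coe_smul, map_smul, map_smul, pairing_add,
    pairing_real_smul, pairing_real_smul]

theorem continuous_pairing_left [Fintype a] [DecidableEq a] [Fintype r]
    (φ : Matrix a a ℂ →ₗ[ℂ] Matrix r r ℂ) :
    Continuous fun X : Matrix (a × r) (a × r) ℂ => pairing X φ := by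
  rw [← ofChoi_choi φ]
  simp only [pairing_ofChoi]
  fun_prop

variable {a₀ a₁ a₁' : Type*} [Fintype a₀] [DecidableEq a₀] [Fintype a₁]
  [DecidableEq a₁] [Fintype a₁'] [DecidableEq a₁']
  {Φ₁ : Matrix a₀ a₀ ℂ →ₗ[ℂ] Matrix a₁ a₁ ℂ} {Φ₂ : Matrix a₀ a₀ ℂ →ₗ[ℂ] Matrix a₁' a₁' ℂ} {ε : ℝ}

theorem IsState.nonempty_snd [Fintype a] [Fintype r] {ρ : Matrix (a × r) (a × r) ℂ}
    (hρ : IsState ρ) : Nonempty r := by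
  by_contra h
  rw [not_nonempty_iff] at h
  simpa [Matrix.trace] using hρ.2

/-- The monotonicity of guessing probabilities under a postprocessing with a dominated error. -/
theorem guessingComparison_of_isCP (hΦ₁ : IsChannel Φ₁) (hε : 0 ≤ ε)
    {Λ : Matrix a₁ a₁ ℂ →ₗ[ℂ] Matrix a₁' a₁' ℂ} {β : Matrix a₀ a₀ ℂ →ₗ[ℂ] Matrix a₁' a₁' ℂ}
    (hΛ : IsChannel Λ) (hβ : IsChannel β)
    (h : IsCP (((ε / 2 : ℝ) : ℂ) • β - (Φ₂ - Λ ∘ₗ Φ₁))) (r : Type*) [Fintype r] [DecidableEq r] :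
    GuessingComparison Φ₁ Φ₂ ε r := by
  intro k p ρ hρ
  have hε2 : 0 ≤ ε / 2 := by positivity
  refine Real.sSup_le ?_ (add_nonneg (guessProb_nonneg (hΦ₁.isEnsemble_tensorId hρ))
    (mul_nonneg hε2 (guessProb_nonneg hρ)))
  rintro x ⟨M, hM, rfl⟩
  have e₁ := sum_trace_tensorId_le_guessProb hΛ (hΦ₁.isEnsemble_tensorId hρ) hM
  have e₀ := mul_le_mul_of_nonneg_left (sum_trace_tensorId_le_guessProb hβ hρ hM) hε2
  refine le_trans ?_ (add_le_add e₁ e₀)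
  rw [Finset.mul_sum, ← Finset.sum_add_distrib]
  refine Finset.sum_le_sum fun i _ => ?_
  have key := (h.tensorId_posSemidef (hρ.2.2 i).1).re_trace_mul_nonneg (hM.1 i)
  simp only [tensorId_sub, tensorId_smul, tensorId_comp, sub_mul, Matrix.smul_mul,
    Matrix.trace_sub, Matrix.trace_smul, Complex.sub_re, smul_eq_mul, Complex.re_ofReal_mul] at key
  have := mul_le_mul_of_nonneg_left (sub_nonneg.1 key) (hρ.1 i)
  linarith

/-- Comparison of guessing probabilities gives comparison of the dual norms, with the
same ancilla. -/
theorem GuessingComparison.dualNormComparison (hΦ₁ : IsChannel Φ₁) (hΦ₂ : IsChannel Φ₂)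
    {r : Type*} [Fintype r] [DecidableEq r] (h : GuessingComparison Φ₁ Φ₂ ε r) :
    DualNormComparison Φ₁ Φ₂ ε r := by
  intro ρ hρ
  have := hρ.nonempty_snd
  let e := (Fintype.equivFin ((r → ℤˣ) × Equiv.Perm r)).symm
  obtain ⟨hens, h₀⟩ := guessProb_signedPermConj hρ e
  have h₁ := (guessProb_signedPermConj (hΦ₁.isState_tensorId hρ) e).2
  have h₂ := (guessProb_signedPermConj (hΦ₂.isState_tensorId hρ) e).2
  have key := h _ _ _ hens
  -- The output ensembles are the twirled ensembles of the output states, so all three terms carry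
  -- the same factor.
  simp only [tensorId_signedPermConj] at key
  rw [h₀, h₁, h₂] at key
  have hc : (0 : ℝ) < Fintype.card r / Fintype.card ((r → ℤˣ) × Equiv.Perm r) :=
    div_pos (by exact_mod_cast Fintype.card_pos) (by exact_mod_cast Fintype.card_pos)
  refine le_of_mul_le_mul_left ?_ hc
  linarith

/-- Comparison of the dual norms with an ancilla isomorphic to the output of `Φ₂` gives a
postprocessing. -/
theorem DualNormComparison.exists_diamondNorm_le [Nonempty a₀] (hΦ₁ : IsChannel Φ₁)
    (hΦ₂ : IsChannel Φ₂) (hε : 0 ≤ ε) {r : Type*} [Fintype r] [DecidableEq r] (e : r ≃ a₁')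
    (h : DualNormComparison Φ₁ Φ₂ ε r) :
    ∃ Λ : Matrix a₁ a₁ ℂ →ₗ[ℂ] Matrix a₁' a₁' ℂ, IsChannel Λ ∧
      diamondNorm (Λ ∘ₗ Φ₁ - Φ₂) ≤ ε := by
  have := hΦ₂.nonempty
  have hr : Nonempty r := e.nonempty
  set ι := (Matrix.reindexLinearEquiv ℂ ℂ e.symm e.symm).toLinearMap
  set ι' := (Matrix.reindexLinearEquiv ℂ ℂ e e).toLinearMap
  have hιc : IsChannel ι := isChannel_reindex e.symm
  have hιc' : IsChannel ι' := isChannel_reindex e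
  have hιι : ι' ∘ₗ ι = LinearMap.id := by
    ext X i j
    simp [ι, ι', Matrix.reindexLinearEquiv]
  -- For fixed channels, `f ≤ 0` on all states says that `ι ∘ Φ₂` is below the postprocessing of
  -- `Φ₁` plus `ε / 2` times a channel.
  let f : Matrix (r × a₁) (r × a₁) ℂ × Matrix (r × a₀) (r × a₀) ℂ →
      Matrix (a₀ × r) (a₀ × r) ℂ → ℝ := fun z ρ =>
    pairing ρ (ι ∘ₗ Φ₂) - pairing (tensorId Φ₁ r ρ) (ofChoi z.1) - ε / 2 * pairing ρ (ofChoi z.2)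
  obtain ⟨⟨C, D⟩, ⟨hC, hD⟩, hCD⟩ := exists_forall_le_zero_of_forall_exists (f := f)
    ((convex_setOf_isChannel_ofChoi (a := a₁) (b := r)).prod
      (convex_setOf_isChannel_ofChoi (a := a₀) (b := r)))
    (isCompact_setOf_isChannel_ofChoi.prod isCompact_setOf_isChannel_ofChoi)
    (convex_setOf_isState (n := a₀ × r)) isCompact_setOf_isState
    (fun ρ => (continuous_const.sub ((continuous_pairing_ofChoi _).comp continuous_fst)).sub
      (continuous_const.mul ((continuous_pairing_ofChoi _).comp continuous_snd)))
    (fun z => ((continuous_pairing_left _).sub (continuous_pairing_left (ofChoi z.1 ∘ₗ Φ₁))).sub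
      (continuous_const.mul (continuous_pairing_left _)))
    (fun z z' ρ s t hst => by
      simp only [f, Prod.fst_add, Prod.snd_add, Prod.smul_fst, Prod.smul_snd,
        pairing_ofChoi_smul_add_smul]
      linear_combination (-pairing ρ (ι ∘ₗ Φ₂)) * hst)
    (fun z ρ ρ' s t hst => by
      simp only [f, ← pairing_comp, pairing_smul_add_smul]
      ring)
    exists_isState
    (fun ρ hρ => by
      obtain ⟨α₁, hα₁, h₁, -⟩ :=
        exists_isChannel_dualDiamondNorm_eq (hΦ₁.isState_tensorId hρ).1
      obtain ⟨α₀, hα₀, h₀, -⟩ := exists_isChannel_dualDiamondNorm_eq hρ.1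
      obtain ⟨-, -, -, h₂⟩ := exists_isChannel_dualDiamondNorm_eq (hΦ₂.isState_tensorId hρ).1
      refine ⟨(choi α₁, choi α₀), ⟨?_, ?_⟩, ?_⟩
      · rwa [Set.mem_ofPred_eq, ofChoi_choi]
      · rwa [Set.mem_ofPred_eq, ofChoi_choi]
      -- The relabelling `ι` competes in the dual norm on the `Φ₂` side; the maximisers `α₁` and
      -- `α₀` attain the two norms on the other side.
      · have e₂ := h₂ ι hιc
        have key := h ρ hρ
        simp only [f, ofChoi_choi]
        rw [← h₁, ← h₀, pairing_comp]
        linarith)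
  have hC' : IsChannel (ofChoi C) := hC
  have hD' : IsChannel (ofChoi D) := hD
  have hcp : IsCP (((ε / 2 : ℝ) : ℂ) • ofChoi D - (ι ∘ₗ Φ₂ - ofChoi C ∘ₗ Φ₁)) := by
    refine isCP_of_forall_pairing_nonneg ?_ fun ρ hρ => ?_
    · rw [choi_sub, choi_smul]
      exact ((isCP_iff_choi_posSemidef.1 hD'.1).real_smul (by positivity)).isHermitian.sub
        (isHermitian_choi_sub (hιc.comp hΦ₂).1 (hC'.comp hΦ₁).1)
    · have := hCD ρ hρ
      simp only [f, ← pairing_comp] at this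
      rw [pairing_sub, pairing_sub, pairing_real_smul]
      linarith
  refine ⟨ι' ∘ₗ ofChoi C, hιc'.comp hC', diamondNorm_sub_le hε ((hιc'.comp hC').comp hΦ₁) hΦ₂
    (hιc'.comp hD') ?_⟩
  have := hιc'.1.comp hcp
  rwa [LinearMap.comp_sub, LinearMap.comp_sub, LinearMap.comp_smul, ← LinearMap.comp_assoc, hιι,
    LinearMap.id_comp, ← LinearMap.comp_assoc] at this

end Comparison

theorem theorem5 {a₀ a₁ a₁' : Type*}
    [Fintype a₀] [DecidableEq a₀] [Nonempty a₀]
    [Fintype a₁] [DecidableEq a₁] [Fintype a₁'] [DecidableEq a₁']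
    (Φ₁ : Matrix a₀ a₀ ℂ →ₗ[ℂ] Matrix a₁ a₁ ℂ) (hΦ₁ : IsChannel Φ₁)
    (Φ₂ : Matrix a₀ a₀ ℂ →ₗ[ℂ] Matrix a₁' a₁' ℂ) (hΦ₂ : IsChannel Φ₂)
    (ε : ℝ) (hε : 0 ≤ ε) :
    IsLeast (postDistances Φ₁ Φ₂) (postDeficiency Φ₁ Φ₂) ∧
    List.TFAE [
      postDeficiency Φ₁ Φ₂ ≤ ε,
      ∀ (r : Type v) [Fintype r] [DecidableEq r], DualNormComparison Φ₁ Φ₂ ε r,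
      ∀ (r : Type v) [Fintype r] [DecidableEq r], GuessingComparison Φ₁ Φ₂ ε r] ∧
    ∀ (r : Type v) [Fintype r] [DecidableEq r], Nonempty (r ≃ a₁') →
      List.TFAE [
        postDeficiency Φ₁ Φ₂ ≤ ε,
        DualNormComparison Φ₁ Φ₂ ε r,
        GuessingComparison Φ₁ Φ₂ ε r] := by

  obtain ⟨t, Λ, β, hΛ, hβ, hcp, hleast⟩ := exists_isLeast_postDistances hΦ₁ hΦ₂
  have ht : postDeficiency Φ₁ Φ₂ = t := hleast.csInf_eq
  have hdom : postDeficiency Φ₁ Φ₂ ≤ ε → IsCP (((ε / 2 : ℝ) : ℂ) • β - (Φ₂ - Λ ∘ₗ Φ₁)) := by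
    intro h
    rw [ht] at h
    -- Domination with the optimal factor `t / 2` persists for the larger factor `ε / 2`.
    have h1 : IsCP ((((ε - t) / 2 : ℝ) : ℂ) • β) := hβ.1.real_smul (by linarith)
    have h2 := h1.add hcp
    rwa [add_sub_assoc', ← add_smul, ← Complex.ofReal_add, ← add_div, sub_add_cancel] at h2
  have hback : ∀ (r : Type v) [Fintype r] [DecidableEq r], Nonempty (r ≃ a₁') →
      DualNormComparison Φ₁ Φ₂ ε r → postDeficiency Φ₁ Φ₂ ≤ ε := by
    rintro r _ _ ⟨e⟩ h
    obtain ⟨M, hM, hle⟩ := h.exists_diamondNorm_le hΦ₁ hΦ₂ hε e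
    rw [ht]
    exact (hleast.2 ⟨M, hM, rfl⟩).trans hle
  refine ⟨ht ▸ hleast, ?_, fun r _ _ hr => ?_⟩
  · tfae_have 1 → 3 := fun h r _ _ => guessingComparison_of_isCP hΦ₁ hε hΛ hβ (hdom h) r
    tfae_have 3 → 2 := fun h r _ _ => (h r).dualNormComparison hΦ₁ hΦ₂
    -- A copy of `a₁'` in the universe of the ancillas.
    tfae_have 2 → 1 := fun h => hback (ULift (Fin (Fintype.card a₁')))
      ⟨Equiv.ulift.trans (Fintype.equivFin a₁').symm⟩ (h _)
    tfae_finish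
  · tfae_have 1 → 3 := fun h => guessingComparison_of_isCP hΦ₁ hε hΛ hβ (hdom h) r
    tfae_have 3 → 2 := fun h => h.dualNormComparison hΦ₁ hΦ₂
    tfae_have 2 → 1 := hback r hr
    tfae_finish
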